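/- Let $n\ge 1$ and let $\mathbb H^n=\mathbb R^{2n+1}$ be the Heisenberg group with coordinates $(x,y,t)$, $x,y\in\mathbb R^n$, and group law $(x,y,t)\cdot(x',y',t')=(x+x',\,y+y',\,t+t'+\tfrac12\sum_j(x_jy'_j-y_jx'_j))$, equipped with Lebesgue measure. For $r>0$ put $B(e,r)=\{(x,y,t): (|x|^2+|y|^2)^2+16t^2<r^4\}$ (the Cygan–Korányi ball around the identity $e=0$), $B=B(e,1)$ and $B_\lambda=B(e,\lambda)$. Let $\theta=dt-\tfrac12\sum_j(x_jdy_j-y_jdx_j)$, let $dx_1,\dots,dx_n,dy_1,\dots,dy_n,\theta$ be an orthonormal left-invariant coframe, and let $(E_0^\bullet,d_c)$ be Rumin's complex: $d_0$ is the weight-preserving algebraic part of the exterior differential $d$ (it vanishes on horizontal covectors and $d_0(\theta\wedge\eta)=d\theta\wedge\eta$ for $\eta$ horizontal), $E_0^h=\ker d_0\cap(\operatorname{Im} d_0)^\perp$ in degree $h$, and $d_c=\Pi_{E_0}\,d\,\Pi_E$, where $\Pi_{E_0}$ is the orthogonal projection on $E_0$ and $\Pi_E$ is the projection on $\ker d_0^{-1}\cap\ker(d_0^{-1}d)$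 along $\operatorname{Im}d_0^{-1}+\operatorname{Im}(d\,d_0^{-1})$, with $d_0^{-1}$ the pseudo-inverse of $d_0$. For $U$ open, $L^p(U,E_0^h)$ denotes the $L^p$ sections of $E_0^h$ over $U$; $d_c$ is understood in the sense of distributions, and a form is $d_c$-exact on $U$ if it equals $d_c$ of a Rumin form on $U$ with distributional coefficients. Consider the following inequalities. * Global $\mathbb H$-Poincaré$_{p,q}(h)$: there is a constant $C$ such that for every $d_c$-exact $\omega\in L^p(\mathbb H^n,E_0^h)$ there is $\phi\in L^q(\mathbb H^n,E_0^{h-1})$ with $d_c\phi=\omega$ and $\|\phi\|_{L^q(\mathbb H^n)}\le C\|\omega\|_{L^p(\mathbb H^n)}$. * Interior $\mathbb H$-Poincaré$_{p,q}(h)$: there are constants $\lambda>1$ and $C$ such that for every $\omega\in L^p(B_\lambda,E_0^h)$ that is $d_c$-exact on $B_\lambda$ there is $\phi\in L^q(B,E_0^{h-1})$ with $d_c\phi=\omega$ on $B$ and $\|\phi\|_{L^q(B)}\le C\|\omega\|_{L^p(B_\lambda)}$. * Global $\mathbb H$-Sobolev$_{p,q}(h)$: there is a constant $C$ such that for every compactly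 supported $d_c$-exact $\omega\in L^p(\mathbb H^n,E_0^h)$ there is a compactly supported $\phi\in L^q(\mathbb H^n,E_0^{h-1})$ with $d_c\phi=\omega$ and $\|\phi\|_{L^q(\mathbb H^n)}\le C\|\omega\|_{L^p(\mathbb H^n)}$. * Interior $\mathbb H$-Sobolev$_{p,q}(h)$: there are constants $\lambda>1$ and $C$ such that for every $\omega\in L^p(B,E_0^h)$ with compact support in $B$ that is $d_c$-exact on $B$ there is $\phi\in L^q(B_\lambda,E_0^{h-1})$ with compact support in $B_\lambda$, with $d_c\phi=\omega$ on $B_\lambda$ ($\omega$ being extended by $0$) and $\|\phi\|_{L^q(B_\lambda)}\le C\|\omega\|_{L^p(B)}$. **Proposition.** Let $2\le h\le 2n+1$ and let $1<p,p'<\infty$ satisfy $\frac1p+\frac1{p'}=1$. If the interior $\mathbb H$-Sobolev$_{1,p'}(2n+2-h)$ inequality holds, then the interior $\mathbb H$-Poincaré$_{p,\infty}(h)$ inequality holds. If the global $\mathbb H$-Sobolev$_{1,p'}(2n+2-h)$ inequality holds, then the global $\mathbb H$-Poincaré$_{p,\infty}(h)$ inequality holds. -/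

import Mathlib

namespace Heisenberg

open MeasureTheory Set TopologicalSpace
open scoped ENNReal NNReal Distributions

noncomputable section

/-! ### The Heisenberg group and the Cygan-Korányi balls -/

/-- The Heisenberg group in exponential coordinates `(x, y, t)`, i.e. `ℝ^(2n+1)`; the coordinates
`0, …, n-1` are `x`, the coordinates `n, …, 2n-1` are `y` and the last one is `t`. The Haar measure
is the Lebesgue measure `volume`. -/
abbrev H (n : ℕ) : Type := EuclideanSpace ℝ (Fin (2 * n + 1))

/-- Index of the coordinate `x_k`. -/
def ix {n : ℕ} (k : Fin n) : Fin (2 * n + 1) := ⟨k, by omega⟩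

/-- Index of the coordinate `y_k`. -/
def iy {n : ℕ} (k : Fin n) : Fin (2 * n + 1) := ⟨n + k, by omega⟩

/-- Index of the coordinate `t`. -/
def it (n : ℕ) : Fin (2 * n + 1) := Fin.last (2 * n)

/-- The group law
`(x,y,t)·(x',y',t') = (x + x', y + y', t + t' + ½ ∑ (x_k y'_k - y_k x'_k))`. -/
def gmul {n : ℕ} (p q : H n) : H n :=
  p + q + EuclideanSpace.single (it n)
    ((1 / 2 : ℝ) * ∑ k : Fin n, (p (ix k) * q (iy k) - p (iy k) * q (ix k)))

/-- The Cygan-Korányi norm `((|x|² + |y|²)² + 16 t²)^(1/4)`. -/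
def gauge {n : ℕ} (p : H n) : ℝ :=
  ((∑ k : Fin n, (p (ix k) ^ 2 + p (iy k) ^ 2)) ^ 2 + 16 * p (it n) ^ 2) ^ (1 / 4 : ℝ)

/-- The Cygan-Korányi distance `ρ(p⁻¹·q)`; the group inverse of `p` is `-p`. -/
def kdist {n : ℕ} (p q : H n) : ℝ := gauge (gmul (-p) q)

theorem continuous_kdist {n : ℕ} (p : H n) : Continuous (kdist p) := by
  have h : Continuous (gmul (-p)) := by
    have : gmul (-p) = fun q : H n => -p + q + (((1 / 2 : ℝ) *
        ∑ k : Fin n, ((-p) (ix k) * q (iy k) - (-p) (iy k) * q (ix k))) •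
          EuclideanSpace.single (it n) (1 : ℝ)) := by
      funext q
      ext i
      simp [gmul]
    rw [this]
    fun_prop
  have h2 : Continuous (gauge (n := n)) := by
    unfold gauge
    refine Continuous.rpow_const (by fun_prop) (fun _ => Or.inr (by norm_num))
  exact h2.comp h

/-- The open Cygan-Korányi ball `B(p, r)`. -/
def kball {n : ℕ} (p : H n) (r : ℝ) : Opens (H n) :=
  ⟨{q | kdist p q < r}, isOpen_lt (continuous_kdist p) continuous_const⟩

/-- The left invariant frame `W_j`, viewed as a vector field on `ℝ^(2n+1)`:
`X_k = ∂_{x_k} - ½ y_k ∂_t`, `Y_k = ∂_{y_k} + ½ x_k ∂_t`, `T = ∂_t`. -/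
def frame {n : ℕ} (j : Fin (2 * n + 1)) (p : H n) : H n :=
  EuclideanSpace.single j 1 +
    (∑ k : Fin n, ((if j = ix k then -(1 / 2 : ℝ) * p (iy k) else 0) +
      (if j = iy k then (1 / 2 : ℝ) * p (ix k) else 0))) • EuclideanSpace.single (it n) (1 : ℝ)

/-! ### Left invariant covectors -/

/-- The exterior algebra of left invariant covectors, with its inner product:
`v` stands for `∑ I, v I • ω_I`, where `ω_I = ω_{i₁} ∧ ⋯ ∧ ω_{i_h}` for `I = {i₁ < ⋯ < i_h}` is the
orthonormal basis built on the coframe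
`(ω_j) = (dx_1, …, dx_n, dy_1, …, dy_n, θ)` dual to the frame `(W_j)`. -/
abbrev Cov (n : ℕ) : Type := EuclideanSpace ℝ (Finset (Fin (2 * n + 1)))

/-- The `h`-covectors. -/
def covDeg (n h : ℕ) : Submodule ℝ (Cov n) where
  carrier := {v | ∀ I : Finset (Fin (2 * n + 1)), I.card ≠ h → v I = 0}
  zero_mem' := by intro I _; rfl
  add_mem' := by
    intro a b ha hb I hI
    simp [ha I hI, hb I hI]
  smul_mem' := by
    intro c a ha I hI
    simp [ha I hI]

/-- `v ↦ ω_j ∧ v`. -/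
def wedgeL {n : ℕ} (j : Fin (2 * n + 1)) : Cov n →ₗ[ℝ] Cov n where
  toFun v := WithLp.toLp 2 fun I =>
    if j ∈ I then (-1 : ℝ) ^ (I.filter (· < j)).card * v (I.erase j) else 0
  map_add' v w := by
    ext I
    by_cases hj : j ∈ I <;> simp [hj, mul_add]
  map_smul' c v := by
    ext I
    by_cases hj : j ∈ I <;> simp [hj, mul_left_comm]

/-- Contraction of a covector with `W_j`. -/
def contr {n : ℕ} (j : Fin (2 * n + 1)) : Cov n →ₗ[ℝ] Cov n where
  toFun v := WithLp.toLp 2 fun I =>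
    if j ∈ I then 0 else (-1 : ℝ) ^ (I.filter (· < j)).card * v (insert j I)
  map_add' v w := by
    ext I
    by_cases hj : j ∈ I <;> simp [hj, mul_add]
  map_smul' c v := by
    ext I
    by_cases hj : j ∈ I <;> simp [hj, mul_left_comm]

/-- The coefficient of `v ∧ w` along the volume form
`dV = dx_1 ∧ ⋯ ∧ dx_n ∧ dy_1 ∧ ⋯ ∧ dy_n ∧ θ`. -/
def wedgeTop {n : ℕ} (v w : Cov n) : ℝ :=
  ∑ I : Finset (Fin (2 * n + 1)),
    (-1 : ℝ) ^ ((I ×ˢ Iᶜ).filter fun ij => ij.2 < ij.1).card * (v I * w Iᶜ)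

/-! ### Rumin's complex -/

/-- The algebraic, weight preserving, part of the exterior differential: it vanishes on horizontal
covectors and maps `θ ∧ η` to `dθ ∧ η` for `η` horizontal, where `dθ = -∑ dx_k ∧ dy_k`. -/
def d₀ (n : ℕ) : Cov n →ₗ[ℝ] Cov n :=
  (-∑ k : Fin n, wedgeL (ix k) ∘ₗ wedgeL (iy k)) ∘ₗ contr (it n)

/-- The pseudo-inverse of an endomorphism `L` of a Euclidean space: it maps `v` to the unique
`u ∈ (ker L)ᗮ` such that `L u - v ∈ (range L)ᗮ`. -/
def pseudoInv {E : Type*} [NormedAddCommGroup E] [InnerProductSpace ℝ E] [FiniteDimensional ℝ E]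
    (L : E →ₗ[ℝ] E) : E →ₗ[ℝ] E :=
  (LinearMap.ker L)ᗮ.subtype ∘ₗ
    (LinearMap.kerComplementEquivRange L
      (Submodule.isCompl_orthogonal (LinearMap.ker L)).symm).symm.toLinearMap ∘ₗ
    ((LinearMap.range L).orthogonalProjectionOnto : E →ₗ[ℝ] LinearMap.range L)

/-- `d₀⁻¹`. -/
def d₀inv (n : ℕ) : Cov n →ₗ[ℝ] Cov n := pseudoInv (d₀ n)

/-- `ker d₀ ∩ (Im d₀)ᗮ`, the sum over all degrees of the spaces of Rumin covectors. -/
def E₀all (n : ℕ) : Submodule ℝ (Cov n) := LinearMap.ker (d₀ n) ⊓ (LinearMap.range (d₀ n))ᗮ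

/-- The space `E₀^h` of Rumin `h`-covectors. -/
def E₀ (n h : ℕ) : Submodule ℝ (Cov n) := covDeg n h ⊓ E₀all n

/-- The derivative along `W_j` of the coefficients of a form. A (smooth) form is a map
`H n → Cov n`, giving its coefficients with respect to the left invariant basis `ω_I`. -/
def W {n : ℕ} (j : Fin (2 * n + 1)) (α : H n → Cov n) (p : H n) : Cov n :=
  fderiv ℝ α p (frame j p)

/-- The part `d₁ = ∑_{j ≤ 2n} ω_j ∧ W_j` of the exterior differential, which raises weights
by one. -/
def d₁ {n : ℕ} (α : H n → Cov n) (p : H n) : Cov n :=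
  ∑ j : Fin (2 * n + 1), if j = it n then 0 else wedgeL j (W j α p)

/-- The part `d₂ = θ ∧ T` of the exterior differential, which raises weights by two. -/
def d₂ {n : ℕ} (α : H n → Cov n) (p : H n) : Cov n :=
  wedgeL (it n) (W (it n) α p)

/-- The exterior differential `d = d₀ + d₁ + d₂` in the left invariant coframe. -/
def extD {n : ℕ} (α : H n → Cov n) (p : H n) : Cov n :=
  d₀ n (α p) + d₁ α p + d₂ α p

/-- The projection `Π_E` on `E = ker d₀⁻¹ ∩ ker (d₀⁻¹ d)` along
`F = Im d₀⁻¹ + Im (d d₀⁻¹)`, on sections `α` of `E₀`: there `Π_E α = α - d₀⁻¹ d₁ α`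
(and the second term vanishes in the degrees `h = 0` and `h > n`). -/
def piE {n : ℕ} (α : H n → Cov n) (p : H n) : Cov n :=
  α p - d₀inv n (d₁ α p)

/-- Rumin's differential `d_c = Π_{E₀} d Π_E` on sections of `E₀`, with `Π_{E₀}` the orthogonal
projection on `E₀`. -/
def dc {n : ℕ} (α : H n → Cov n) (p : H n) : Cov n :=
  (E₀all n).starProjection (extD (piE α) p)

/-! ### `d_c` on test forms -/

theorem contDiff_frame {n : ℕ} (j : Fin (2 * n + 1)) : ContDiff ℝ (⊤ : ℕ∞) (frame (n := n) j) := by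
  unfold frame
  refine contDiff_const.add (ContDiff.fun_smul (ContDiff.sum fun k _ => ?_) contDiff_const)
  refine ContDiff.add ?_ ?_
  · split_ifs <;> fun_prop
  · split_ifs <;> fun_prop

theorem contDiff_W {n : ℕ} (j : Fin (2 * n + 1)) {α : H n → Cov n} (hα : ContDiff ℝ (⊤ : ℕ∞) α) :
    ContDiff ℝ (⊤ : ℕ∞) (W j α) := by
  unfold W
  exact (hα.fderiv_right (m := (⊤ : ℕ∞)) (by simp)).clm_apply (contDiff_frame j)

theorem contDiff_lin {n : ℕ} (L : Cov n →ₗ[ℝ] Cov n) {α : H n → Cov n}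
    (hα : ContDiff ℝ (⊤ : ℕ∞) α) : ContDiff ℝ (⊤ : ℕ∞) fun p => L (α p) :=
  (LinearMap.toContinuousLinearMap L).contDiff.comp hα

theorem contDiff_d₁ {n : ℕ} {α : H n → Cov n} (hα : ContDiff ℝ (⊤ : ℕ∞) α) : ContDiff ℝ (⊤ : ℕ∞) (d₁ α) := by
  unfold d₁
  refine ContDiff.sum fun j _ => ?_
  split_ifs
  · exact contDiff_const
  · exact contDiff_lin _ (contDiff_W j hα)

theorem contDiff_piE {n : ℕ} {α : H n → Cov n} (hα : ContDiff ℝ (⊤ : ℕ∞) α) : ContDiff ℝ (⊤ : ℕ∞) (piE α) :=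
  hα.sub (contDiff_lin _ (contDiff_d₁ hα))

theorem contDiff_dc {n : ℕ} {α : H n → Cov n} (hα : ContDiff ℝ (⊤ : ℕ∞) α) : ContDiff ℝ (⊤ : ℕ∞) (dc α) := by
  have h := contDiff_piE hα
  exact (E₀all n).starProjection.contDiff.comp
    (((contDiff_lin _ h).add (contDiff_d₁ h)).add (contDiff_lin _ (contDiff_W _ h)))

theorem W_eq_zero {n : ℕ} (j : Fin (2 * n + 1)) {α : H n → Cov n} {p : H n}
    (hp : p ∉ tsupport α) : W j α p = 0 := by
  have : fderiv ℝ α p = 0 := by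
    by_contra h
    exact hp (support_fderiv_subset ℝ h)
  simp [W, this]

theorem d₁_eq_zero {n : ℕ} {α : H n → Cov n} {p : H n} (hp : p ∉ tsupport α) : d₁ α p = 0 := by
  simp [d₁, W_eq_zero _ hp]

theorem tsupport_piE {n : ℕ} (α : H n → Cov n) : tsupport (piE α) ⊆ tsupport α := by
  refine closure_minimal (fun p hp => ?_) (isClosed_tsupport α)
  by_contra h
  exact hp (by simp [piE, d₁_eq_zero h, image_eq_zero_of_notMem_tsupport h])

theorem tsupport_dc {n : ℕ} (α : H n → Cov n) : tsupport (dc α) ⊆ tsupport α := by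
  refine closure_minimal (fun p hp => ?_) (isClosed_tsupport α)
  by_contra h'
  have h : p ∉ tsupport (piE α) := fun h => h' (tsupport_piE α h)
  exact hp (by simp [dc, extD, d₂, d₁_eq_zero h, W_eq_zero _ h,
    image_eq_zero_of_notMem_tsupport h])

/-- `d_c` as an operator on compactly supported smooth forms in the open set `U`. -/
def dcTest {n : ℕ} {U : Opens (H n)} (α : 𝓓(U, Cov n)) : 𝓓(U, Cov n) where
  toFun := dc α
  contDiff' := contDiff_dc α.contDiff
  hasCompactSupport' := α.hasCompactSupport.mono' ((subset_tsupport _).trans (tsupport_dc _))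
  tsupport_subset' := (tsupport_dc _).trans α.tsupport_subset

/-- `α ∈ 𝓓(U, E₀^m)`: the test form `α` is a Rumin form of degree `m`. -/
def IsTestForm {n : ℕ} (m : ℕ) {U : Opens (H n)} (α : 𝓓(U, Cov n)) : Prop :=
  ∀ p, α p ∈ E₀ n m

/-! ### `L^p` forms, `d_c` in the sense of distributions, exactness -/

/-- `ω ∈ L^p(U, E₀^h)`. -/
structure IsLpForm {n : ℕ} (h : ℕ) (p : ℝ≥0∞) (U : Opens (H n)) (ω : H n → Cov n) : Prop where
  memLp : MemLp ω p (volume.restrict (U : Set (H n)))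
  mem_E₀ : ∀ᵐ x ∂volume.restrict (U : Set (H n)), ω x ∈ E₀ n h

/-- `‖ω‖_{L^p(U)}`. -/
def lpNorm {n : ℕ} (p : ℝ≥0∞) (U : Opens (H n)) (ω : H n → Cov n) : ℝ≥0∞ :=
  eLpNorm ω p (volume.restrict (U : Set (H n)))

/-- The form `ω` on `U`, defined up to null sets, has compact support in `U`. -/
def CompactlySupportedIn {n : ℕ} (U : Opens (H n)) (ω : H n → Cov n) : Prop :=
  ∃ K : Set (H n), IsCompact K ∧ K ⊆ U ∧
    ∀ᵐ x ∂volume.restrict (U : Set (H n)), x ∉ K → ω x = 0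

/-- `d_c φ = ω` on `U` in the sense of distributions, for a locally integrable section `φ` of
`E₀^(h-1)` and a locally integrable section `ω` of `E₀^h` (`h ≥ 1`):
`∫_U ω ∧ α = (-1)^h ∫_U φ ∧ d_c α` for all test forms `α` of degree `2n+1-h`. -/
def WeakDc {n : ℕ} (h : ℕ) (U : Opens (H n)) (φ ω : H n → Cov n) : Prop :=
  ∀ α : 𝓓(U, Cov n), IsTestForm (2 * n + 1 - h) α →
    ∫ x in (U : Set (H n)), wedgeTop (ω x) (α x) =
      (-1 : ℝ) ^ h * ∫ x in (U : Set (H n)), wedgeTop (φ x) (dc α x)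

/-- The `h`-form `ω` is `d_c`-exact on `U` (`h ≥ 1`): `ω = d_c T` in the sense of distributions for
some Rumin `(h-1)`-form `T` on `U` with distributional coefficients. Such a `T` is a continuous
linear form on test forms of degree `2n+2-h`, a locally integrable `φ` being identified
with `β ↦ ∫_U φ ∧ β`; it extends to all test functions with values in `Cov n`. -/
def IsDcExact {n : ℕ} (h : ℕ) (U : Opens (H n)) (ω : H n → Cov n) : Prop :=
  ∃ T : 𝓓(U, Cov n) →L[ℝ] ℝ,
    ∀ α : 𝓓(U, Cov n), IsTestForm (2 * n + 1 - h) α →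
      ∫ x in (U : Set (H n)), wedgeTop (ω x) (α x) = (-1 : ℝ) ^ h * T (dcTest α)

/-! ### The inequalities -/

/-- The global `ℍ`-Poincaré_{p,q}(h) inequality on the Heisenberg group. -/
def GlobalPoincare (n h : ℕ) (p q : ℝ≥0∞) : Prop :=
  ∃ C : ℝ≥0, ∀ ω : H n → Cov n, IsLpForm h p ⊤ ω → IsDcExact h ⊤ ω →
    ∃ φ : H n → Cov n, IsLpForm (h - 1) q ⊤ φ ∧ WeakDc h ⊤ φ ω ∧
      lpNorm q ⊤ φ ≤ C * lpNorm p ⊤ ω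

/-- The interior `ℍ`-Poincaré_{p,q}(h) inequality on the Heisenberg group. -/
def InteriorPoincare (n h : ℕ) (p q : ℝ≥0∞) : Prop :=
  ∃ l : ℝ, 1 < l ∧ ∃ C : ℝ≥0, ∀ ω : H n → Cov n,
    IsLpForm h p (kball 0 l) ω → IsDcExact h (kball 0 l) ω →
      ∃ φ : H n → Cov n, IsLpForm (h - 1) q (kball 0 1) φ ∧ WeakDc h (kball 0 1) φ ω ∧
        lpNorm q (kball 0 1) φ ≤ C * lpNorm p (kball 0 l) ω

/-- The global `ℍ`-Sobolev_{p,q}(h) inequality on the Heisenberg group. -/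
def GlobalSobolev (n h : ℕ) (p q : ℝ≥0∞) : Prop :=
  ∃ C : ℝ≥0, ∀ ω : H n → Cov n,
    IsLpForm h p ⊤ ω → CompactlySupportedIn ⊤ ω → IsDcExact h ⊤ ω →
      ∃ φ : H n → Cov n, IsLpForm (h - 1) q ⊤ φ ∧ CompactlySupportedIn ⊤ φ ∧ WeakDc h ⊤ φ ω ∧
        lpNorm q ⊤ φ ≤ C * lpNorm p ⊤ ω

/-- The interior `ℍ`-Sobolev_{p,q}(h) inequality on the Heisenberg group; `ω` is extended by `0`
outside the unit ball. -/
def InteriorSobolev (n h : ℕ) (p q : ℝ≥0∞) : Prop :=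
  ∃ l : ℝ, 1 < l ∧ ∃ C : ℝ≥0, ∀ ω : H n → Cov n,
    IsLpForm h p (kball 0 1) ω → CompactlySupportedIn (kball 0 1) ω →
      IsDcExact h (kball 0 1) ω →
        ∃ φ : H n → Cov n, IsLpForm (h - 1) q (kball 0 l) φ ∧
          CompactlySupportedIn (kball 0 l) φ ∧
          WeakDc h (kball 0 l) φ ((kball (0 : H n) 1 : Set (H n)).indicator ω) ∧
          lpNorm q (kball 0 l) φ ≤ C * lpNorm p (kball 0 1) ω

end

end Heisenberg

namespace Heisenberg

open MeasureTheory Set TopologicalSpace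
open scoped ENNReal NNReal Distributions Pointwise

noncomputable section

/-! The proof is a duality argument. Let `ω` be `d_c`-exact in `L^p(V)`, and let `α` be a test form
of degree `2n+1-h` in `U ⊆ V`; here `U` and `V` are the balls of radii 1 and λ, or both the whole
group. The Sobolev inequality for the smooth form `d_c α` gives a compactly supported `ψ` with `d_c
ψ = d_c α` and `‖ψ‖_{p'} ≤ C ‖d_c α‖_1`. Then `α - ψ` is closed with compact support, so it pairs to
zero with the exact form `ω`, and Hölder gives `|∫ ω ∧ α| = |∫ ω ∧ ψ| ≤ C ‖ω‖_p ‖d_c α‖_1`. Hence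
`d_c α ↦ (-1)^h ∫ ω ∧ α` is well defined and bounded for the `L^1` norm. By Hahn-Banach and `(L^1)*
= L^∞` it is the pairing with a bounded form `φ`, which says that `d_c φ = ω` weakly, with the same
constant `C` (`exists_bounded_primitive`).

The analytic point is that closed forms are orthogonal to exact ones although the potential `T` of
`ω` is only a distribution and `χ = α - ψ` is only in `L^{p'}`
(`integral_wedgeTop_eq_zero_of_closed`). The form `χ` is smoothed by convolution on the left with a
test function `η`. Since `d_c` is left invariant, `η * χ` is still closed (`dc_gconv_eq_zero`), so
`∫ ω ∧ (η * χ) = ± T(d_c(η * χ)) = 0`. Letting `η` vary near the identity and using the continuity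
of translations in `L^{p'}`, `p' < ∞`, gives `∫ ω ∧ χ = 0`.

The algebraic point is that `d_c` is, up to sign, its own formal transpose for the wedge pairing
(`integral_wedgeTop_dc`). This follows from the same fact for `d`, because Hodge duality exchanges
`ker d₀` with `(Im d₀)ᗮ`, and so the corrections introduced by `Π_E` and `Π_{E₀}` pair to zero. -/

variable {n : ℕ}

/-! ### Hodge duality on covectors -/

/-- The number of inversions of the pair `(I, Iᶜ)`. -/
def inversions (I : Finset (Fin (2 * n + 1))) : ℕ :=
  ((I ×ˢ Iᶜ).filter fun ij => ij.2 < ij.1).card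

theorem inversions_eq_sum (I : Finset (Fin (2 * n + 1))) :
    inversions I = ∑ i ∈ I, (Iᶜ.filter (· < i)).card := by
  simp only [inversions, Finset.card_filter, Finset.sum_product]

/-- When `j` moves from the complement into the set, the inversions `(i, j)` with `i ∈ K` above `j`
are lost, and the inversions `(j, k)` with `k ∉ K` below `j` are gained. -/
theorem inversions_insert {j : Fin (2 * n + 1)} {K : Finset (Fin (2 * n + 1))} (hj : j ∉ K) :
    inversions (insert j K) + (K.filter (j < ·)).card =
      inversions K + (Kᶜ.filter (· < j)).card := by
  have hc : Kᶜ = insert j (insert j K)ᶜ := by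
    ext i
    by_cases h : i = j <;> simp [h, hj]
  have hj' : j ∉ (insert j K)ᶜ := by simp
  rw [inversions_eq_sum, inversions_eq_sum, Finset.sum_insert hj, Finset.card_filter (j < ·) K, hc,
    Finset.filter_insert, if_neg (lt_irrefl j), add_assoc, ← Finset.sum_add_distrib, add_comm]
  congr 1
  refine Finset.sum_congr rfl fun i _ => ?_
  rw [Finset.filter_insert]
  split_ifs with h
  · rw [Finset.card_insert_of_notMem (by simp)]
  · rfl

theorem neg_one_pow_inversions_insert {j : Fin (2 * n + 1)} {K : Finset (Fin (2 * n + 1))}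
    (hj : j ∉ K) :
    (-1 : ℝ) ^ inversions (insert j K) * (-1) ^ (K.filter (· < j)).card =
      (-1) ^ K.card * ((-1) ^ inversions K * (-1) ^ (Kᶜ.filter (· < j)).card) := by
  have h1 := inversions_insert hj
  have h2 : (K.filter (· < j)).card + (K.filter (j < ·)).card = K.card := by
    rw [← Finset.card_union_of_disjoint]
    · congr 1
      ext i
      simp only [Finset.mem_union, Finset.mem_filter]
      constructor
      · tauto
      · intro hi
        have : i ≠ j := fun h => hj (h ▸ hi)
        rcases lt_or_gt_of_ne this with h | h <;> tauto
    · rw [Finset.disjoint_filter]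
      intro i _ h
      exact h.asymm
  rw [← pow_add, ← pow_add, ← pow_add, ← h1, ← h2]
  exact neg_one_pow_congr (by rw [Nat.even_add, Nat.even_add, Nat.even_add, Nat.even_add]; tauto)

/-- Matching `I` with `I ∪ {j}` is the change of index that carries `ω_j` from one factor of a wedge
product to the other. -/
theorem sum_ite_mem_eq_sum_insert (j : Fin (2 * n + 1)) (f : Finset (Fin (2 * n + 1)) → ℝ) :
    ∑ I, (if j ∈ I then f I else 0) = ∑ I, if j ∈ I then 0 else f (insert j I) := by
  rw [← Finset.sum_filter, ← Finset.sum_filter_add_sum_filter_not Finset.univ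
    (fun I : Finset (Fin (2 * n + 1)) => j ∈ I) fun I => if j ∈ I then 0 else f (insert j I),
    Finset.sum_eq_zero (s := Finset.univ.filter fun I : Finset (Fin (2 * n + 1)) => j ∈ I)
      (f := fun I => if j ∈ I then 0 else f (insert j I)), zero_add]
  · refine Finset.sum_bij' (fun I _ => I.erase j) (fun I _ => insert j I) ?_ ?_ ?_ ?_ ?_
    · simp
    · simp
    · simp only [Finset.mem_filter, Finset.mem_univ, true_and]
      exact fun I hI => Finset.insert_erase hI
    · simp only [Finset.mem_filter, Finset.mem_univ, true_and]
      exact fun I hI => Finset.erase_insert hI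
    · simp only [Finset.mem_filter, Finset.mem_univ, true_and]
      intro I hI
      simp [Finset.insert_erase hI]
  · simp only [Finset.mem_filter, Finset.mem_univ, true_and]
    intro I hI
    simp [hI]

/-- The parity operator, `(-1)^h` on `h`-covectors. -/
def parity : Cov n →ₗ[ℝ] Cov n where
  toFun v := WithLp.toLp 2 fun I => (-1 : ℝ) ^ I.card * v I
  map_add' v w := by
    ext I
    simp [mul_add]
  map_smul' c v := by
    ext I
    simp [mul_left_comm]

@[simp] theorem parity_apply (v : Cov n) (I : Finset (Fin (2 * n + 1))) :
    parity v I = (-1 : ℝ) ^ I.card * v I := rfl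

theorem wedgeL_apply (j : Fin (2 * n + 1)) (v : Cov n) (I : Finset (Fin (2 * n + 1))) :
    wedgeL j v I = if j ∈ I then (-1 : ℝ) ^ (I.filter (· < j)).card * v (I.erase j) else 0 := rfl

theorem contr_apply (j : Fin (2 * n + 1)) (v : Cov n) (I : Finset (Fin (2 * n + 1))) :
    contr j v I = if j ∈ I then 0 else (-1 : ℝ) ^ (I.filter (· < j)).card * v (insert j I) := rfl

theorem parity_parity (v : Cov n) : parity (parity v) = v := by
  ext I
  simp [← mul_assoc, ← mul_pow]

theorem parity_wedgeL (j : Fin (2 * n + 1)) (v : Cov n) :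
    parity (wedgeL j v) = -wedgeL j (parity v) := by
  ext I
  by_cases hj : j ∈ I
  · simp only [parity_apply, wedgeL_apply, hj, PiLp.neg_apply, if_true]
    rw [← Finset.card_erase_add_one hj]
    ring
  · simp [wedgeL_apply, hj]

theorem parity_contr (j : Fin (2 * n + 1)) (v : Cov n) :
    parity (contr j v) = -contr j (parity v) := by
  ext I
  by_cases hj : j ∈ I
  · simp [contr_apply, hj]
  · simp only [parity_apply, contr_apply, hj, PiLp.neg_apply, if_false,
      Finset.card_insert_of_notMem hj]
    ring

theorem wedgeTop_eq (v w : Cov n) :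
    wedgeTop v w = ∑ I, (-1 : ℝ) ^ inversions I * (v I * w Iᶜ) := rfl

theorem erase_compl_insert (j : Fin (2 * n + 1)) (K : Finset (Fin (2 * n + 1))) :
    Kᶜ.erase j = (insert j K)ᶜ := by
  ext i; simp

theorem insert_compl_insert {j : Fin (2 * n + 1)} {K : Finset (Fin (2 * n + 1))} (hj : j ∉ K) :
    insert j (insert j K)ᶜ = Kᶜ := by
  ext i
  by_cases h : i = j <;> simp [h, hj]

theorem filter_insert_self (j : Fin (2 * n + 1)) (K : Finset (Fin (2 * n + 1))) :
    (insert j K).filter (· < j) = K.filter (· < j) := by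
  rw [Finset.filter_insert, if_neg (lt_irrefl j)]

theorem filter_compl_insert (j : Fin (2 * n + 1)) (K : Finset (Fin (2 * n + 1))) :
    (insert j K)ᶜ.filter (· < j) = Kᶜ.filter (· < j) := by
  ext i
  simp only [Finset.mem_filter, Finset.mem_compl, Finset.mem_insert, not_or]
  constructor
  · tauto
  · rintro ⟨h1, h2⟩
    exact ⟨⟨h2.ne, h1⟩, h2⟩

/-- Moving `ω_j` past `v` costs `(-1)^deg v`, which `parity` records without fixing a degree. -/
theorem wedgeTop_wedgeL (j : Fin (2 * n + 1)) (v w : Cov n) :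
    wedgeTop (wedgeL j v) w = wedgeTop (parity v) (wedgeL j w) := by
  have h1 : wedgeTop (wedgeL j v) w = ∑ I, if j ∈ I then
      (-1 : ℝ) ^ inversions I * ((-1 : ℝ) ^ (I.filter (· < j)).card * v (I.erase j) * w Iᶜ)
      else 0 := by
    rw [wedgeTop_eq]
    refine Finset.sum_congr rfl fun I _ => ?_
    by_cases hj : j ∈ I <;> simp [wedgeL_apply, hj]
  rw [h1, sum_ite_mem_eq_sum_insert, wedgeTop_eq]
  refine Finset.sum_congr rfl fun I _ => ?_
  by_cases hj : j ∈ I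
  · simp [wedgeL_apply, hj]
  · have := neg_one_pow_inversions_insert hj
    simp only [hj, if_false, wedgeL_apply, Finset.mem_compl, not_false_iff, if_true, parity_apply,
      Finset.erase_insert hj, erase_compl_insert, filter_insert_self]
    linear_combination (v I * w (insert j I)ᶜ) * this

/-- Contraction is an antiderivation, and a contracted covector has no component along the volume
form. -/
theorem wedgeTop_contr (j : Fin (2 * n + 1)) (v w : Cov n) :
    wedgeTop (contr j v) w = -wedgeTop (parity v) (contr j w) := by
  have h1 : wedgeTop (parity v) (contr j w) = ∑ I, if j ∈ I then
      (-1 : ℝ) ^ inversions I * ((-1) ^ I.card * v I *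
        ((-1 : ℝ) ^ (Iᶜ.filter (· < j)).card * w (insert j Iᶜ)))
      else 0 := by
    rw [wedgeTop_eq]
    refine Finset.sum_congr rfl fun I _ => ?_
    by_cases hj : j ∈ I <;> simp [contr_apply, hj]
  rw [h1, sum_ite_mem_eq_sum_insert, wedgeTop_eq, ← Finset.sum_neg_distrib]
  refine Finset.sum_congr rfl fun I _ => ?_
  by_cases hj : j ∈ I
  · simp [contr_apply, hj]
  · have h2 := neg_one_pow_inversions_insert hj
    have h3 : ∀ k : ℕ, (-1 : ℝ) ^ k * (-1) ^ k = 1 := fun k => by simp [← mul_pow]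
    have hA := h3 (I.filter (· < j)).card
    have hB := h3 (Iᶜ.filter (· < j)).card
    have hC := h3 I.card
    simp only [hj, if_false, contr_apply, filter_compl_insert, insert_compl_insert hj,
      Finset.card_insert_of_notMem hj, pow_succ]
    generalize (-1 : ℝ) ^ inversions (insert j I) = a at *
    generalize (-1 : ℝ) ^ inversions I = b at *
    generalize (-1 : ℝ) ^ (I.filter (· < j)).card = c at *
    generalize (-1 : ℝ) ^ (Iᶜ.filter (· < j)).card = d at *
    generalize (-1 : ℝ) ^ I.card = e at *
    -- All five letters are signs; this is `h2` rearranged with `c² = d² = e² = 1`.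
    have : b * c = a * e * d := by
      linear_combination (-(e * d * c)) * h2 + a * e * d * hA - b * c * e * e * hB - b * c * hC
    linear_combination (v (insert j I) * w Iᶜ) * this

/-! ### Anticommutation of wedge products and contractions -/

theorem neg_one_pow_filter_insert {j : Fin (2 * n + 1)} {I : Finset (Fin (2 * n + 1))}
    (hj : j ∉ I) (k : Fin (2 * n + 1)) :
    (-1 : ℝ) ^ ((insert j I).filter (· < k)).card =
      (if j < k then -1 else 1) * (-1) ^ (I.filter (· < k)).card := by
  rw [Finset.filter_insert]
  split_ifs with h
  · rw [Finset.card_insert_of_notMem (by simp [hj]), pow_succ]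
    ring
  · simp

theorem contr_wedgeL {j k : Fin (2 * n + 1)} (h : j ≠ k) (v : Cov n) :
    contr j (wedgeL k v) = -wedgeL k (contr j v) := by
  ext I
  simp only [contr_apply, wedgeL_apply, PiLp.neg_apply, Finset.mem_insert, Finset.mem_erase]
  by_cases hj : j ∈ I
  · simp [hj, h]
  by_cases hk : k ∈ I
  · obtain ⟨J, hkJ, rfl⟩ : ∃ J, k ∉ J ∧ I = insert k J :=
      ⟨I.erase k, by simp, (Finset.insert_erase hk).symm⟩
    have hjJ : j ∉ J := fun h => hj (Finset.mem_insert_of_mem h)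
    have h1 : (insert j (insert k J)).erase k = insert j J := by
      rw [Finset.insert_comm, Finset.erase_insert (by simp [hkJ, h.symm])]
    simp only [hj, hk, if_false, if_true, or_true, and_false, Finset.erase_insert hkJ, h1]
    rw [neg_one_pow_filter_insert hj, neg_one_pow_filter_insert hkJ j]
    -- Exactly one of `j < k` and `k < j` holds, so exactly one of the two signs flips.
    rcases lt_or_gt_of_ne h with h | h
    · simp only [h, h.asymm, if_true, if_false]
      ring
    · simp only [h, h.asymm, if_true, if_false]
      ring
  · simp [hj, hk, h.symm]

theorem wedgeL_comm {j k : Fin (2 * n + 1)} (h : j ≠ k) (v : Cov n) :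
    wedgeL j (wedgeL k v) = -wedgeL k (wedgeL j v) := by
  ext I
  simp only [wedgeL_apply, PiLp.neg_apply, Finset.mem_erase]
  by_cases hj : j ∈ I
  · by_cases hk : k ∈ I
    · obtain ⟨J, hjJ, rfl⟩ : ∃ J, j ∉ J ∧ I = insert j J :=
        ⟨I.erase j, by simp, (Finset.insert_erase hj).symm⟩
      obtain ⟨K, hkK, rfl⟩ : ∃ K, k ∉ K ∧ J = insert k K :=
        ⟨J.erase k, by simp,
          (Finset.insert_erase (Finset.mem_of_mem_insert_of_ne hk h.symm)).symm⟩
      have hjK : j ∉ K := fun h => hjJ (Finset.mem_insert_of_mem h)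
      have h1 : (insert j (insert k K)).erase k = insert j K := by
        rw [Finset.insert_comm, Finset.erase_insert (by simp [hkK, h.symm])]
      simp only [hj, hk, h, h.symm, ne_eq, not_false_iff, and_self, if_true,
        Finset.erase_insert hjJ, h1, Finset.erase_insert hkK, Finset.erase_insert hjK]
      rw [neg_one_pow_filter_insert hjJ, neg_one_pow_filter_insert hjJ,
        neg_one_pow_filter_insert hkK, neg_one_pow_filter_insert hkK,
        neg_one_pow_filter_insert hjK]
      rcases lt_or_gt_of_ne h with h | h
      · simp only [h, h.asymm, if_true, if_false, lt_irrefl]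
        ring
      · simp only [h, h.asymm, if_true, if_false, lt_irrefl]
        ring
    · simp [hk]
  · simp [hj]

theorem ix_ne_it (k : Fin n) : ix k ≠ it n := by
  intro h
  have := congrArg Fin.val h
  simp [ix, it] at this
  omega

theorem iy_ne_it (k : Fin n) : iy k ≠ it n := by
  intro h
  have := congrArg Fin.val h
  simp [iy, it] at this
  omega

theorem ix_ne_iy (k l : Fin n) : ix k ≠ iy l := by
  intro h
  have := congrArg Fin.val h
  simp [ix, iy] at this
  omega

theorem d₀_apply (v : Cov n) :
    d₀ n v = -∑ k : Fin n, wedgeL (ix k) (wedgeL (iy k) (contr (it n) v)) := by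
  simp [d₀]

/-- Hodge duality, `⟪star v, w⟫ = v ∧ w`. -/
def star : Cov n ≃ₗᵢ[ℝ] Cov n where
  toFun v := WithLp.toLp 2 fun I => (-1 : ℝ) ^ inversions Iᶜ * v Iᶜ
  invFun v := WithLp.toLp 2 fun I => (-1 : ℝ) ^ inversions I * v Iᶜ
  left_inv v := by
    ext I
    simp [← mul_assoc, ← mul_pow]
  right_inv v := by
    ext I
    simp [← mul_assoc, ← mul_pow]
  map_add' v w := by
    ext I
    simp [mul_add]
  map_smul' c v := by
    ext I
    simp [mul_left_comm]
  norm_map' v := by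
    rw [EuclideanSpace.norm_eq, EuclideanSpace.norm_eq]
    congr 1
    refine Fintype.sum_equiv (Function.Involutive.toPerm compl compl_involutive) _ _ fun I => ?_
    simp

theorem star_apply (v : Cov n) (I : Finset (Fin (2 * n + 1))) :
    star v I = (-1 : ℝ) ^ inversions Iᶜ * v Iᶜ := rfl

theorem star_symm_apply (v : Cov n) (I : Finset (Fin (2 * n + 1))) :
    star.symm v I = (-1 : ℝ) ^ inversions I * v Iᶜ := rfl

theorem wedgeTop_eq_inner (v w : Cov n) : wedgeTop v w = inner ℝ (star v) w := by
  rw [wedgeTop_eq, PiLp.inner_apply]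
  refine Fintype.sum_equiv (Function.Involutive.toPerm compl compl_involutive) _ _ fun I => ?_
  simp [star_apply]
  ring

theorem inner_star_star (v w : Cov n) : inner ℝ (star v) (star w) = inner ℝ v w :=
  star.inner_map_map v w

theorem abs_wedgeTop_le (v w : Cov n) : |wedgeTop v w| ≤ ‖v‖ * ‖w‖ := by
  rw [wedgeTop_eq_inner, ← star.norm_map v]
  exact abs_real_inner_le_norm _ _

/-- `wedgeTop` as a continuous bilinear map. -/
def wedgeTopL : Cov n →L[ℝ] Cov n →L[ℝ] ℝ :=
  (innerSL ℝ).comp (star (n := n)).toContinuousLinearEquiv.toContinuousLinearMap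

@[simp] theorem wedgeTopL_apply (v w : Cov n) : wedgeTopL v w = wedgeTop v w :=
  (wedgeTop_eq_inner v w).symm

theorem wedgeTop_neg_left (v w : Cov n) : wedgeTop (-v) w = -wedgeTop v w := by
  simp [← wedgeTopL_apply]

theorem wedgeTop_neg_right (v w : Cov n) : wedgeTop v (-w) = -wedgeTop v w := by
  simp [← wedgeTopL_apply]

/-- Integration by parts at order zero. The three odd factors of `d₀` are moved to `w` one at a
time; they arrive in reverse order, and anticommutation restores the order with total sign `-1`. -/
theorem wedgeTop_d₀ (v w : Cov n) : wedgeTop (d₀ n v) w = -wedgeTop (parity v) (d₀ n w) := by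
  rw [d₀_apply, d₀_apply, wedgeTop_neg_left, wedgeTop_neg_right]
  congr 1
  simp only [← wedgeTopL_apply, map_sum, FunLike.coe_sum, Finset.sum_apply, ← Finset.sum_neg_distrib]
  refine Finset.sum_congr rfl fun k _ => ?_
  simp only [wedgeTopL_apply]
  rw [wedgeTop_wedgeL, parity_wedgeL, wedgeTop_neg_left, wedgeTop_wedgeL, parity_parity,
    wedgeTop_contr, contr_wedgeL (iy_ne_it k).symm, contr_wedgeL (ix_ne_it k).symm, map_neg,
    neg_neg, wedgeL_comm (ix_ne_iy k k).symm, neg_neg,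
    wedgeTop_neg_right]

theorem parity_d₀ (v : Cov n) : parity (d₀ n v) = -d₀ n (parity v) := by
  simp [d₀_apply, parity_wedgeL, parity_contr]

theorem inner_parity (v w : Cov n) : inner ℝ (parity v) w = inner ℝ v (parity w) := by
  simp only [PiLp.inner_apply, parity_apply]
  refine Finset.sum_congr rfl fun I _ => ?_
  simp
  ring

/-! ### Duality of the algebraic operators of Rumin's complex -/

theorem mem_range_d₀_orthogonal {u : Cov n} :
    u ∈ (LinearMap.range (d₀ n))ᗮ ↔ ∀ w, inner ℝ u (d₀ n w) = 0 := by
  rw [Submodule.mem_orthogonal']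
  simp

theorem d₀_parity_eq_zero {u : Cov n} (hu : d₀ n u = 0) : d₀ n (parity u) = 0 := by
  rw [← neg_eq_zero, ← parity_d₀, hu, map_zero]

/-- By `wedgeTop_d₀`, `star` conjugates `d₀` to its adjoint up to parity. Hence `star` and its
inverse exchange `ker d₀` and `(Im d₀)ᗮ`, and so preserve Rumin covectors; this and the next lemmas
are the four inclusions. -/
theorem d₀_star_of_mem_orthogonal {u : Cov n} (hu : u ∈ (LinearMap.range (d₀ n))ᗮ) :
    d₀ n (star u) = 0 := by
  rw [mem_range_d₀_orthogonal] at hu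
  rw [← inner_self_eq_zero (𝕜 := ℝ)]
  -- With one copy of `d₀ (star u)` written as `star (parity v)`, its squared norm becomes a wedge
  -- pairing, and `d₀` can be moved onto `v`.
  obtain ⟨v, hv⟩ : ∃ v, star (parity v) = d₀ n (star u) :=
    ⟨parity (star.symm (d₀ n (star u))), by rw [parity_parity, star.apply_symm_apply]⟩
  nth_rw 1 [← hv]
  rw [← wedgeTop_eq_inner, ← neg_eq_zero, ← wedgeTop_d₀, wedgeTop_eq_inner, inner_star_star,
    real_inner_comm, hu]

theorem d₀_star_symm_of_mem_orthogonal {u : Cov n} (hu : u ∈ (LinearMap.range (d₀ n))ᗮ) :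
    d₀ n (star.symm u) = 0 := by
  rw [mem_range_d₀_orthogonal] at hu
  have h : d₀ n (parity (star.symm u)) = 0 := by
    rw [← star.map_eq_zero_iff, ← inner_self_eq_zero (𝕜 := ℝ), ← wedgeTop_eq_inner, wedgeTop_d₀,
      parity_parity, wedgeTop_eq_inner, star.apply_symm_apply, hu, neg_zero]
  simpa [parity_parity] using d₀_parity_eq_zero h

theorem star_mem_orthogonal {u : Cov n} (hu : d₀ n u = 0) :
    star u ∈ (LinearMap.range (d₀ n))ᗮ := by
  rw [mem_range_d₀_orthogonal]
  intro w
  rw [← wedgeTop_eq_inner, ← parity_parity u, ← neg_eq_zero, ← wedgeTop_d₀, d₀_parity_eq_zero hu]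
  simp [← wedgeTopL_apply]

theorem star_symm_mem_orthogonal {u : Cov n} (hu : d₀ n u = 0) :
    star.symm u ∈ (LinearMap.range (d₀ n))ᗮ := by
  rw [mem_range_d₀_orthogonal]
  intro w
  rw [← inner_star_star, star.apply_symm_apply, real_inner_comm, ← wedgeTop_eq_inner, wedgeTop_d₀,
    hu]
  simp [← wedgeTopL_apply]

theorem star_mem_E₀all {u : Cov n} (hu : u ∈ E₀all n) : star u ∈ E₀all n :=
  ⟨d₀_star_of_mem_orthogonal hu.2, star_mem_orthogonal hu.1⟩

theorem star_symm_mem_E₀all {u : Cov n} (hu : u ∈ E₀all n) : star.symm u ∈ E₀all n :=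
  ⟨d₀_star_symm_of_mem_orthogonal hu.2, star_symm_mem_orthogonal hu.1⟩

theorem star_mem_E₀ {m : ℕ} (hm : m ≤ 2 * n + 1) {u : Cov n} (hu : u ∈ E₀ n m) :
    star u ∈ E₀ n (2 * n + 1 - m) := by
  refine ⟨fun I hI => ?_, star_mem_E₀all hu.2⟩
  rw [star_apply, hu.1 Iᶜ, mul_zero]
  rw [Finset.card_compl, Fintype.card_fin]
  have := Finset.card_le_univ I
  rw [Fintype.card_fin] at this
  omega

theorem star_symm_mem_E₀ {m : ℕ} (hm : m ≤ 2 * n + 1) {u : Cov n} (hu : u ∈ E₀ n m) :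
    star.symm u ∈ E₀ n (2 * n + 1 - m) := by
  refine ⟨fun I hI => ?_, star_symm_mem_E₀all hu.2⟩
  rw [star_symm_apply, hu.1 Iᶜ, mul_zero]
  rw [Finset.card_compl, Fintype.card_fin]
  have := Finset.card_le_univ I
  rw [Fintype.card_fin] at this
  omega

/-! ### The pseudo-inverse and its pairing with Rumin covectors -/

section PseudoInv

variable {E : Type*} [NormedAddCommGroup E] [InnerProductSpace ℝ E] [FiniteDimensional ℝ E]

theorem pseudoInv_mem (L : E →ₗ[ℝ] E) (z : E) : pseudoInv L z ∈ (LinearMap.ker L)ᗮ := by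
  simp [pseudoInv]

theorem sub_pseudoInv_mem (L : E →ₗ[ℝ] E) (z : E) :
    z - L (pseudoInv L z) ∈ (LinearMap.range L)ᗮ := by
  have : L (pseudoInv L z) = (LinearMap.range L).starProjection z := by
    have h := (LinearMap.kerComplementEquivRange L
      (Submodule.isCompl_orthogonal (LinearMap.ker L)).symm).apply_symm_apply
        ((LinearMap.range L).orthogonalProjectionOnto z)
    exact congrArg Subtype.val h
  rw [this]
  exact Submodule.sub_starProjection_mem_orthogonal z

end PseudoInv

theorem inner_d₀inv {x : Cov n} (hx : d₀ n x = 0) (z : Cov n) : inner ℝ (d₀inv n z) x = 0 :=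
  (Submodule.mem_orthogonal' _ _).1 (pseudoInv_mem (d₀ n) z) x hx

/-- The values of `d₀⁻¹` are orthogonal to `ker d₀`, which contains `star u`. This and the next
lemma discard the term `d₀⁻¹ d₁` of `Π_E` under the integral. -/
theorem wedgeTop_d₀inv_right {u : Cov n} (hu : u ∈ (LinearMap.range (d₀ n))ᗮ) (z : Cov n) :
    wedgeTop u (d₀inv n z) = 0 := by
  rw [wedgeTop_eq_inner, real_inner_comm, inner_d₀inv (d₀_star_of_mem_orthogonal hu)]

theorem wedgeTop_parity_d₀inv_left {u : Cov n} (hu : u ∈ (LinearMap.range (d₀ n))ᗮ) (z : Cov n) :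
    wedgeTop (parity (d₀inv n z)) u = 0 := by
  rw [wedgeTop_eq_inner, ← star.apply_symm_apply u, inner_star_star, inner_parity,
    inner_d₀inv (d₀_parity_eq_zero (d₀_star_symm_of_mem_orthogonal hu))]

theorem wedgeTop_proj_left (v : Cov n) {u : Cov n} (hu : u ∈ E₀all n) :
    wedgeTop ((E₀all n).starProjection v) u = wedgeTop v u := by
  rw [wedgeTop_eq_inner, wedgeTop_eq_inner, ← star.apply_symm_apply u, inner_star_star,
    inner_star_star, Submodule.inner_starProjection_left_eq_right,
    Submodule.starProjection_eq_self_iff.2 (star_symm_mem_E₀all hu)]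

theorem wedgeTop_proj_right {u : Cov n} (hu : u ∈ E₀all n) (v : Cov n) :
    wedgeTop u ((E₀all n).starProjection v) = wedgeTop u v := by
  rw [wedgeTop_eq_inner, wedgeTop_eq_inner, ← Submodule.inner_starProjection_left_eq_right,
    Submodule.starProjection_eq_self_iff.2 (star_mem_E₀all hu)]

/-! ### Degrees -/

/-- The degree operator, multiplication by `h` on `h`-covectors. -/
def degOp : Cov n →ₗ[ℝ] Cov n where
  toFun v := WithLp.toLp 2 fun I => (I.card : ℝ) * v I
  map_add' v w := by
    ext I
    simp [mul_add]
  map_smul' c v := by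
    ext I
    simp [mul_left_comm]

theorem degOp_apply (v : Cov n) (I : Finset (Fin (2 * n + 1))) :
    degOp v I = (I.card : ℝ) * v I := rfl

/-- Seeing degrees as eigenspaces of one self-adjoint operator lets the degrees of `d₀⁻¹` and of the
projection on `E₀` be read off commutation relations. -/
theorem mem_covDeg_iff {m : ℕ} {v : Cov n} : v ∈ covDeg n m ↔ degOp v = (m : ℝ) • v := by
  constructor
  · intro hv
    ext I
    by_cases hI : I.card = m
    · simp [degOp_apply, hI]
    · simp [degOp_apply, hv I hI]
  · intro hv I hI
    have := congrArg (fun w : Cov n => w I) hv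
    simp only [degOp_apply, PiLp.smul_apply, smul_eq_mul, mul_eq_mul_right_iff,
      Nat.cast_inj] at this
    tauto

theorem parity_of_mem_covDeg {m : ℕ} {v : Cov n} (hv : v ∈ covDeg n m) :
    parity v = (-1 : ℝ) ^ m • v := by
  ext I
  by_cases hI : I.card = m
  · simp [hI]
  · simp [hv I hI]

theorem inner_degOp (v w : Cov n) : inner ℝ (degOp v) w = inner ℝ v (degOp w) := by
  simp only [PiLp.inner_apply, degOp_apply]
  refine Finset.sum_congr rfl fun I _ => ?_
  simp
  ring

theorem degOp_wedgeL (j : Fin (2 * n + 1)) (v : Cov n) :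
    degOp (wedgeL j v) = wedgeL j (degOp v) + wedgeL j v := by
  ext I
  by_cases hj : j ∈ I
  · simp only [degOp_apply, wedgeL_apply, hj, PiLp.add_apply, if_true]
    rw [← Finset.card_erase_add_one hj]
    push_cast
    ring
  · simp [degOp_apply, wedgeL_apply, hj]

theorem degOp_contr (j : Fin (2 * n + 1)) (v : Cov n) :
    degOp (contr j v) = contr j (degOp v) - contr j v := by
  ext I
  by_cases hj : j ∈ I
  · simp [degOp_apply, contr_apply, hj]
  · simp only [degOp_apply, contr_apply, hj, PiLp.sub_apply, if_false,
      Finset.card_insert_of_notMem hj]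
    push_cast
    ring

theorem degOp_d₀ (v : Cov n) : degOp (d₀ n v) = d₀ n (degOp v) + d₀ n v := by
  simp only [d₀_apply, map_neg, map_sum, degOp_wedgeL, degOp_contr, map_add, map_sub,
    Finset.sum_add_distrib, Finset.sum_sub_distrib]
  abel

theorem d₀_degOp_eq_zero {v : Cov n} (hv : d₀ n v = 0) : d₀ n (degOp v) = 0 := by
  have := degOp_d₀ v
  rw [hv, map_zero, add_zero] at this
  exact this.symm

theorem degOp_mem_orthogonal {v : Cov n} (hv : v ∈ (LinearMap.range (d₀ n))ᗮ) :
    degOp v ∈ (LinearMap.range (d₀ n))ᗮ := by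
  rw [mem_range_d₀_orthogonal] at hv ⊢
  intro w
  rw [inner_degOp, degOp_d₀, inner_add_right, hv, hv, add_zero]

theorem degOp_mem_E₀all {v : Cov n} (hv : v ∈ E₀all n) : degOp v ∈ E₀all n :=
  ⟨d₀_degOp_eq_zero hv.1, degOp_mem_orthogonal hv.2⟩

/-- The defect `degOp u - m u` is orthogonal to `ker d₀`. Its image under `d₀` lies both in the
range and in its orthogonal, so the defect also lies in `ker d₀`, and vanishes. -/
theorem d₀inv_mem_covDeg {m : ℕ} {z : Cov n} (hz : z ∈ covDeg n (m + 1)) :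
    d₀inv n z ∈ covDeg n m := by
  rw [mem_covDeg_iff] at hz ⊢
  rw [← sub_eq_zero]
  set u := d₀inv n z with hu
  have h1 : z - d₀ n u ∈ (LinearMap.range (d₀ n))ᗮ := sub_pseudoInv_mem (d₀ n) z
  have h2 : ∀ x, d₀ n x = 0 → inner ℝ (degOp u - (m : ℝ) • u) x = 0 := by
    intro x hx
    rw [inner_sub_left, inner_smul_left, inner_degOp, inner_d₀inv hx,
      inner_d₀inv (d₀_degOp_eq_zero hx)]
    simp
  have h3 : d₀ n (degOp u - (m : ℝ) • u) =
      -(degOp (z - d₀ n u) - ((m + 1 : ℕ) : ℝ) • (z - d₀ n u)) := by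
    rw [map_sub degOp, hz, degOp_d₀, map_sub, map_smul]
    push_cast
    module
  have h4 : d₀ n (degOp u - (m : ℝ) • u) ∈ (LinearMap.range (d₀ n))ᗮ := by
    rw [h3]
    exact neg_mem (sub_mem (degOp_mem_orthogonal h1) (Submodule.smul_mem _ _ h1))
  rw [mem_range_d₀_orthogonal] at h4
  exact inner_self_eq_zero.1 (h2 _ (inner_self_eq_zero.1 (h4 _)))

/-- The defect `degOp e - m e` lies in `E₀` and, since `degOp` is self-adjoint and preserves `E₀`,
is also orthogonal to it. -/
theorem proj_mem_covDeg {m : ℕ} {z : Cov n} (hz : z ∈ covDeg n m) :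
    (E₀all n).starProjection z ∈ covDeg n m := by
  rw [mem_covDeg_iff] at hz ⊢
  rw [← sub_eq_zero]
  set e := (E₀all n).starProjection z
  have he : e ∈ E₀all n := Submodule.starProjection_apply_mem _ _
  have h1 : degOp e - (m : ℝ) • e ∈ E₀all n :=
    sub_mem (degOp_mem_E₀all he) (Submodule.smul_mem _ _ he)
  have h2 : ∀ x ∈ E₀all n, inner ℝ (z - e) x = 0 :=
    (Submodule.mem_orthogonal' _ _).1 (Submodule.sub_starProjection_mem_orthogonal z)
  have h3 : degOp e - (m : ℝ) • e = -(degOp (z - e) - (m : ℝ) • (z - e)) := by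
    rw [map_sub, hz]
    module
  refine inner_self_eq_zero (𝕜 := ℝ) |>.1 ?_
  nth_rw 1 [h3]
  rw [inner_neg_left, inner_sub_left, inner_smul_left, inner_degOp, h2 _ h1,
    h2 _ (degOp_mem_E₀all h1)]
  simp

/-- The covectors `v` with `v I = 0` whenever `t ∉ I`, i.e. the multiples of `θ`. -/
def vertical (n : ℕ) : Submodule ℝ (Cov n) where
  carrier := {v | ∀ I : Finset (Fin (2 * n + 1)), it n ∉ I → v I = 0}
  zero_mem' := by intro I _; rfl
  add_mem' := by
    intro a b ha hb I hI
    simp [ha I hI, hb I hI]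
  smul_mem' := by
    intro c a ha I hI
    simp [ha I hI]

theorem wedgeL_it_mem_vertical (v : Cov n) : wedgeL (it n) v ∈ vertical n := by
  intro I hI
  simp [wedgeL_apply, hI]

theorem wedgeL_mem_vertical {j : Fin (2 * n + 1)} {v : Cov n} (hv : v ∈ vertical n) :
    wedgeL j v ∈ vertical n := by
  intro I hI
  rw [wedgeL_apply]
  split_ifs
  · rw [hv _ fun h => hI (Finset.mem_of_mem_erase h), mul_zero]
  · rfl

/-- The contraction with `T` can be moved outermost, so the image of `d₀` is horizontal. -/
theorem d₀_apply_eq_zero (v : Cov n) {I : Finset (Fin (2 * n + 1))} (hI : it n ∈ I) :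
    d₀ n v I = 0 := by
  have : d₀ n v = -∑ k : Fin n, contr (it n) (wedgeL (ix k) (wedgeL (iy k) v)) := by
    rw [d₀_apply]
    simp only [contr_wedgeL (ix_ne_it _).symm, contr_wedgeL (iy_ne_it _).symm, map_neg, neg_neg]
  simp [this, contr_apply, hI]

theorem vertical_le_orthogonal : vertical n ≤ (LinearMap.range (d₀ n))ᗮ := by
  intro v hv
  rw [mem_range_d₀_orthogonal]
  intro w
  rw [PiLp.inner_apply]
  refine Finset.sum_eq_zero fun I _ => ?_
  by_cases hI : it n ∈ I
  · simp [d₀_apply_eq_zero w hI]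
  · simp [hv I hI]

/-- Horizontal basis covectors lie in `ker d₀`, to which the values of `d₀⁻¹` are orthogonal. -/
theorem d₀inv_mem_vertical (z : Cov n) : d₀inv n z ∈ vertical n := by
  intro I hI
  have h : d₀ n (EuclideanSpace.single I (1 : ℝ)) = 0 := by
    have : contr (it n) (EuclideanSpace.single I (1 : ℝ)) = 0 := by
      ext J
      rw [contr_apply]
      split_ifs with hJ
      · rfl
      · have : insert (it n) J ≠ I := fun h => hI (h ▸ Finset.mem_insert_self _ _)
        simp [this]
    simp [d₀_apply, this]
  simpa [EuclideanSpace.inner_single_right] using inner_d₀inv h z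

/-! ### Calculus along the left invariant frame -/

theorem W_lin (L : Cov n →ₗ[ℝ] Cov n) (j : Fin (2 * n + 1)) {α : H n → Cov n} {p : H n}
    (hα : DifferentiableAt ℝ α p) : W j (fun q => L (α q)) p = L (W j α p) := by
  have := (LinearMap.toContinuousLinearMap L).hasFDerivAt.comp p hα.hasFDerivAt
  have h2 : fderiv ℝ (fun q => L (α q)) p = (LinearMap.toContinuousLinearMap L).comp (fderiv ℝ α p) :=
    this.fderiv
  simp [W, h2]

theorem W_add (j : Fin (2 * n + 1)) {α β : H n → Cov n} {p : H n}
    (hα : DifferentiableAt ℝ α p) (hβ : DifferentiableAt ℝ β p) :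
    W j (fun q => α q + β q) p = W j α p + W j β p := by
  simp [W, fderiv_fun_add hα hβ]

theorem W_sub (j : Fin (2 * n + 1)) {α β : H n → Cov n} {p : H n}
    (hα : DifferentiableAt ℝ α p) (hβ : DifferentiableAt ℝ β p) :
    W j (fun q => α q - β q) p = W j α p - W j β p := by
  simp [W, fderiv_fun_sub hα hβ]

theorem W_mem (S : Submodule ℝ (Cov n)) (j : Fin (2 * n + 1)) {α : H n → Cov n} {p : H n}
    (hα : DifferentiableAt ℝ α p) (hS : ∀ q, α q ∈ S) : W j α p ∈ S := by
  have h : W j α p = S.starProjection (W j α p) := by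
    conv_lhs => rw [show α = fun q => S.starProjection.toLinearMap (α q) from
      funext fun q => (Submodule.starProjection_eq_self_iff.2 (hS q)).symm]
    rw [W_lin _ _ hα]
    rfl
  rw [h]
  exact Submodule.starProjection_apply_mem _ _

theorem W_congr (j : Fin (2 * n + 1)) {α β : H n → Cov n} {p : H n} (h : α =ᶠ[nhds p] β) :
    W j α p = W j β p := by
  rw [W, W, h.fderiv_eq]

theorem d₁_congr {α β : H n → Cov n} {p : H n} (h : α =ᶠ[nhds p] β) : d₁ α p = d₁ β p := by
  simp only [d₁, W_congr _ h]

theorem piE_congr {α β : H n → Cov n} {p : H n} (h : α =ᶠ[nhds p] β) :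
    piE α =ᶠ[nhds p] piE β := by
  filter_upwards [eventually_eventually_nhds.2 h] with q hq
  rw [piE, piE, d₁_congr hq, Filter.EventuallyEq.eq_of_nhds hq]

theorem dc_congr {α β : H n → Cov n} {p : H n} (h : α =ᶠ[nhds p] β) : dc α p = dc β p := by
  have h' := piE_congr h
  rw [dc, dc, extD, extD, d₂, d₂, d₁_congr h', W_congr _ h', h'.eq_of_nhds]

theorem extD_eq (α : H n → Cov n) (p : H n) :
    extD α p = d₀ n (α p) + ∑ j, wedgeL j (W j α p) := by
  rw [extD, add_assoc, d₁, d₂, ← Finset.add_sum_erase _ _ (Finset.mem_univ (it n)),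
    ← Finset.add_sum_erase (a := it n) _ (fun j => wedgeL j (W j α p)) (Finset.mem_univ (it n)),
    if_pos rfl, zero_add, add_comm (wedgeL _ _)]
  congr 2
  refine Finset.sum_congr rfl fun j hj => ?_
  rw [if_neg (Finset.ne_of_mem_erase hj)]

theorem contDiff_extD {α : H n → Cov n} (hα : ContDiff ℝ (⊤ : ℕ∞) α) :
    ContDiff ℝ (⊤ : ℕ∞) (extD α) :=
  ((contDiff_lin _ hα).add (contDiff_d₁ hα)).add (contDiff_lin _ (contDiff_W _ hα))

theorem differentiable_of_contDiff {α : H n → Cov n} (hα : ContDiff ℝ (⊤ : ℕ∞) α) :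
    Differentiable ℝ α := hα.differentiable (by simp)

theorem dc_add {α β : H n → Cov n} (hα : ContDiff ℝ (⊤ : ℕ∞) α) (hβ : ContDiff ℝ (⊤ : ℕ∞) β)
    (p : H n) : dc (fun q => α q + β q) p = dc α p + dc β p := by
  have h1 : ∀ {α β : H n → Cov n}, ContDiff ℝ (⊤ : ℕ∞) α → ContDiff ℝ (⊤ : ℕ∞) β →
      d₁ (fun q => α q + β q) = fun q => d₁ α q + d₁ β q := by
    intro α β hα hβ
    funext q
    rw [d₁, d₁, d₁, ← Finset.sum_add_distrib]
    refine Finset.sum_congr rfl fun j _ => ?_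
    split_ifs
    · simp
    · rw [W_add _ (differentiable_of_contDiff hα q) (differentiable_of_contDiff hβ q), map_add]
  have h2 : piE (fun q => α q + β q) = fun q => piE α q + piE β q := by
    funext q
    simp only [piE, h1 hα hβ, map_add]
    abel
  have h3 := contDiff_piE hα
  have h4 := contDiff_piE hβ
  rw [dc, dc, dc, ← map_add, h2, extD, extD, extD, h1 h3 h4, d₂, d₂, d₂,
    W_add _ (differentiable_of_contDiff h3 p) (differentiable_of_contDiff h4 p)]
  simp only [map_add]
  abel

theorem dc_smul {α : H n → Cov n} (hα : ContDiff ℝ (⊤ : ℕ∞) α) (c : ℝ)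
    (p : H n) : dc (fun q => c • α q) p = c • dc α p := by
  have h1 : ∀ {α : H n → Cov n}, ContDiff ℝ (⊤ : ℕ∞) α →
      d₁ (fun q => c • α q) = fun q => c • d₁ α q := by
    intro α hα
    funext q
    rw [d₁, d₁, Finset.smul_sum]
    refine Finset.sum_congr rfl fun j _ => ?_
    split_ifs
    · simp
    · rw [← map_smul]
      exact congrArg _ (W_lin (c • LinearMap.id) j (differentiable_of_contDiff hα q))
  have h2 : piE (fun q => c • α q) = fun q => c • piE α q := by
    funext q
    simp only [piE, h1 hα, map_smul, smul_sub]
  have h3 := contDiff_piE hα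
  have h4 : W (it n) (fun q => c • piE α q) p = c • W (it n) (piE α) p :=
    W_lin (c • LinearMap.id) _ (differentiable_of_contDiff h3 p)
  rw [dc, dc, ← map_smul, h2, extD, extD, h1 h3, d₂, d₂, h4, map_smul, map_smul, smul_add,
    smul_add]

/-! ### Values of `d_c` -/

theorem wedgeL_mem_covDeg {m : ℕ} (j : Fin (2 * n + 1)) {v : Cov n} (hv : v ∈ covDeg n m) :
    wedgeL j v ∈ covDeg n (m + 1) := by
  rw [mem_covDeg_iff] at hv ⊢
  rw [degOp_wedgeL, hv, map_smul]
  push_cast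
  module

theorem d₀_mem_covDeg {m : ℕ} {v : Cov n} (hv : v ∈ covDeg n m) : d₀ n v ∈ covDeg n (m + 1) := by
  rw [mem_covDeg_iff] at hv ⊢
  rw [degOp_d₀, hv, map_smul]
  push_cast
  module

theorem extD_mem_covDeg {m : ℕ} {α : H n → Cov n} (hα : ContDiff ℝ (⊤ : ℕ∞) α)
    (h : ∀ p, α p ∈ covDeg n m) (p : H n) : extD α p ∈ covDeg n (m + 1) := by
  rw [extD_eq]
  exact add_mem (d₀_mem_covDeg (h p)) (sum_mem fun j _ =>
    wedgeL_mem_covDeg j (W_mem _ j (differentiable_of_contDiff hα p) h))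

theorem d₁_mem_covDeg {m : ℕ} {α : H n → Cov n} (hα : ContDiff ℝ (⊤ : ℕ∞) α)
    (h : ∀ p, α p ∈ covDeg n m) (p : H n) : d₁ α p ∈ covDeg n (m + 1) := by
  rw [d₁]
  refine sum_mem fun j _ => ?_
  split_ifs
  · exact zero_mem _
  · exact wedgeL_mem_covDeg j (W_mem _ j (differentiable_of_contDiff hα p) h)

theorem dc_mem_E₀ {m : ℕ} {α : H n → Cov n} (hα : ContDiff ℝ (⊤ : ℕ∞) α)
    (h : ∀ p, α p ∈ E₀ n m) (p : H n) : dc α p ∈ E₀ n (m + 1) := by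
  refine ⟨proj_mem_covDeg (extD_mem_covDeg (contDiff_piE hα) (fun q => ?_) p),
    Submodule.starProjection_apply_mem _ _⟩
  exact sub_mem (h q).1 (d₀inv_mem_covDeg (d₁_mem_covDeg hα (fun p => (h p).1) q))

theorem d₁_mem_vertical {α : H n → Cov n} (hα : ContDiff ℝ (⊤ : ℕ∞) α)
    (h : ∀ p, α p ∈ vertical n) (p : H n) : d₁ α p ∈ vertical n := by
  rw [d₁]
  refine sum_mem fun j _ => ?_
  split_ifs
  · exact zero_mem _
  · exact wedgeL_mem_vertical (W_mem _ j (differentiable_of_contDiff hα p) h)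

/-- With `η = d₀⁻¹ d₁ α`, `d Π_E α` is `d₁ α - d₀ η`, orthogonal to the range by the choice of the
pseudo-inverse, plus terms divisible by `θ`, while the range is horizontal. This is the property
that makes pairings of `d Π_E α` with `d₀⁻¹` vanish. -/
theorem extD_piE_mem_orthogonal {α : H n → Cov n} (hα : ContDiff ℝ (⊤ : ℕ∞) α)
    (h : ∀ p, α p ∈ E₀all n) (p : H n) :
    extD (piE α) p ∈ (LinearMap.range (d₀ n))ᗮ := by
  set η : H n → Cov n := fun q => d₀inv n (d₁ α q) with hη
  have hη' : ContDiff ℝ (⊤ : ℕ∞) η := contDiff_lin _ (contDiff_d₁ hα)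
  have h1 : d₁ (piE α) p = d₁ α p - d₁ η p := by
    rw [d₁, d₁, d₁, ← Finset.sum_sub_distrib]
    refine Finset.sum_congr rfl fun j _ => ?_
    split_ifs
    · simp
    · rw [← map_sub, ← W_sub _ (differentiable_of_contDiff hα p) (differentiable_of_contDiff hη' p)]
      rfl
  have h2 : d₀ n (piE α p) = -d₀ n (η p) := by
    rw [piE, map_sub, show d₀ n (α p) = 0 from (h p).1, zero_sub]
  have h3 : extD (piE α) p = (d₁ α p - d₀ n (η p)) + (d₂ (piE α) p - d₁ η p) := by
    rw [extD, h1, h2]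
    abel
  rw [h3]
  refine add_mem (sub_pseudoInv_mem (d₀ n) _) (vertical_le_orthogonal (sub_mem ?_ ?_))
  · exact wedgeL_it_mem_vertical _
  · exact d₁_mem_vertical hη' (fun q => d₀inv_mem_vertical _) p

/-! ### Integration by parts -/

/-- The coefficient of `∂_t` in the left invariant vector field `W_j`. -/
def frameCoeff (j : Fin (2 * n + 1)) : H n →L[ℝ] ℝ :=
  ∑ k : Fin n, ((if j = ix k then -(1 / 2 : ℝ) else 0) • EuclideanSpace.proj (iy k) +
    (if j = iy k then (1 / 2 : ℝ) else 0) • EuclideanSpace.proj (ix k))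

theorem frameCoeff_apply (j : Fin (2 * n + 1)) (p : H n) :
    frameCoeff j p = ∑ k : Fin n, ((if j = ix k then -(1 / 2 : ℝ) else 0) * p (iy k) +
      (if j = iy k then (1 / 2 : ℝ) else 0) * p (ix k)) := by
  simp only [frameCoeff, FunLike.coe_sum, Finset.sum_apply, FunLike.coe_add, Pi.add_apply,
    FunLike.coe_smul, Pi.smul_apply, smul_eq_mul]
  rfl

theorem frame_eq (j : Fin (2 * n + 1)) (p : H n) :
    frame j p = EuclideanSpace.single j 1 +
      frameCoeff j p • EuclideanSpace.single (it n) (1 : ℝ) := by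
  simp [frame, frameCoeff_apply]

theorem frameCoeff_single_it (j : Fin (2 * n + 1)) :
    frameCoeff j (EuclideanSpace.single (it n) (1 : ℝ)) = 0 := by
  simp [frameCoeff_apply, ix_ne_it, iy_ne_it]

/-- `W_j = ∂_j + c_j ∂_t` is divergence free, because the linear coefficient `c_j` does not depend
on `t`. -/
theorem integral_fderiv_frame (j : Fin (2 * n + 1)) {f : H n → ℝ} (hf : ContDiff ℝ 1 f)
    (hs : HasCompactSupport f) : ∫ p, fderiv ℝ f p (frame j p) = 0 := by
  have hd : Differentiable ℝ f := hf.differentiable one_ne_zero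
  have hc : ∀ v : H n, Continuous fun p => fderiv ℝ f p v := fun v =>
    (hf.continuous_fderiv one_ne_zero).clm_apply continuous_const
  have hs' : ∀ v : H n, HasCompactSupport fun p => fderiv ℝ f p v := fun v => hs.fderiv_apply ℝ v
  have h1 : ∫ p, fderiv ℝ f p (EuclideanSpace.single j (1 : ℝ)) = 0 := by
    have := integral_mul_fderiv_eq_neg_fderiv_mul_of_integrable (μ := (volume : Measure (H n)))
      (f := fun _ => (1 : ℝ)) (g := f) (v := EuclideanSpace.single j (1 : ℝ))
      (by simp) (by simpa using (hc _).integrable_of_hasCompactSupport (hs' _))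
      (by simpa using hf.continuous.integrable_of_hasCompactSupport hs)
      (fun x _ => differentiableAt_const _) (fun x _ => hd x)
    simpa using this
  have h2 : ∫ p, frameCoeff j p * fderiv ℝ f p (EuclideanSpace.single (it n) (1 : ℝ)) = 0 := by
    have := integral_mul_fderiv_eq_neg_fderiv_mul_of_integrable (μ := (volume : Measure (H n)))
      (f := frameCoeff j) (g := f) (v := EuclideanSpace.single (it n) (1 : ℝ))
      (by simp [frameCoeff_single_it])
      (((frameCoeff j).continuous.mul (hc _)).integrable_of_hasCompactSupport (hs' _).mul_left)
      (((frameCoeff j).continuous.mul hf.continuous).integrable_of_hasCompactSupport hs.mul_left)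
      (fun x _ => (frameCoeff j).differentiableAt) (fun x _ => hd x)
    simpa [frameCoeff_single_it] using this
  simp only [frame_eq, map_add, map_smul, smul_eq_mul]
  have hi : Integrable fun p =>
      frameCoeff j p * fderiv ℝ f p (EuclideanSpace.single (it n) (1 : ℝ)) :=
    ((frameCoeff j).continuous.mul (hc _)).integrable_of_hasCompactSupport (hs' _).mul_left
  rw [integral_add ((hc _).integrable_of_hasCompactSupport (hs' _)) hi, h1, h2, add_zero]

theorem contDiff_wedgeTop {α β : H n → Cov n} {m : WithTop ℕ∞} (hα : ContDiff ℝ m α)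
    (hβ : ContDiff ℝ m β) : ContDiff ℝ m fun p => wedgeTop (α p) (β p) := by
  simp only [← wedgeTopL_apply]
  exact (wedgeTopL.contDiff.comp hα).clm_apply hβ

theorem fderiv_wedgeTop (j : Fin (2 * n + 1)) {α β : H n → Cov n} {p : H n}
    (hα : DifferentiableAt ℝ α p) (hβ : DifferentiableAt ℝ β p) :
    fderiv ℝ (fun q => wedgeTop (α q) (β q)) p (frame j p) =
      wedgeTop (W j α p) (β p) + wedgeTop (α p) (W j β p) := by
  simp only [← wedgeTopL_apply]
  rw [(wedgeTopL.hasFDerivAt_of_bilinear hα.hasFDerivAt hβ.hasFDerivAt).fderiv]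
  simp [W, add_comm]

theorem hasCompactSupport_wedgeTop (α : H n → Cov n) {β : H n → Cov n}
    (hβ : HasCompactSupport β) : HasCompactSupport fun p => wedgeTop (α p) (β p) :=
  hβ.mono fun p hp => by
    contrapose! hp
    simp only [Function.mem_support, not_not] at hp ⊢
    rw [hp, ← wedgeTopL_apply, map_zero]

theorem integrable_wedgeTop {α β : H n → Cov n} (hα : Continuous α) (hβ : Continuous β)
    (hs : HasCompactSupport β) : Integrable fun p => wedgeTop (α p) (β p) := by
  refine Continuous.integrable_of_hasCompactSupport ?_ (hasCompactSupport_wedgeTop α hs)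
  simp only [← wedgeTopL_apply]
  fun_prop

theorem hasCompactSupport_extD {α : H n → Cov n} (hs : HasCompactSupport α) :
    HasCompactSupport (extD α) := by
  refine hs.mono' fun p hp => ?_
  by_contra h
  exact hp (by simp [extD, d₂, d₁_eq_zero h, W_eq_zero _ h, image_eq_zero_of_notMem_tsupport h])

theorem hasCompactSupport_piE {α : H n → Cov n} (hs : HasCompactSupport α) :
    HasCompactSupport (piE α) :=
  hs.mono' ((subset_tsupport _).trans (tsupport_piE _))

theorem hasCompactSupport_dc {α : H n → Cov n} (hs : HasCompactSupport α) :
    HasCompactSupport (dc α) :=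
  hs.mono' ((subset_tsupport _).trans (tsupport_dc _))

/-- The `d₀` terms cancel by `wedgeTop_d₀`; what remains is the sum of the derivatives `W_j` of the
compactly supported functions `parity α ∧ ω_j ∧ β`. -/
theorem integral_wedgeTop_extD {α β : H n → Cov n} (hα : ContDiff ℝ (⊤ : ℕ∞) α)
    (hβ : ContDiff ℝ (⊤ : ℕ∞) β) (hs : HasCompactSupport β) :
    ∫ p, wedgeTop (extD α p) (β p) = -∫ p, wedgeTop (parity (α p)) (extD β p) := by
  have hP : ContDiff ℝ (⊤ : ℕ∞) fun p => parity (α p) := contDiff_lin _ hα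
  have h0 : ∀ p, wedgeTop (extD α p) (β p) + wedgeTop (parity (α p)) (extD β p) =
      ∑ j, fderiv ℝ (fun q => wedgeTop (parity (α q)) (wedgeL j (β q))) p (frame j p) := by
    intro p
    have hα' := differentiable_of_contDiff hα p
    have hβ' := differentiable_of_contDiff hβ p
    have h1 : ∀ j, fderiv ℝ (fun q => wedgeTop (parity (α q)) (wedgeL j (β q))) p (frame j p) =
        wedgeTop (wedgeL j (W j α p)) (β p) + wedgeTop (parity (α p)) (wedgeL j (W j β p)) := by
      intro j
      rw [fderiv_wedgeTop j (differentiable_of_contDiff hP p)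
        (differentiable_of_contDiff (contDiff_lin _ hβ) p), W_lin _ _ hα', W_lin _ _ hβ',
        wedgeTop_wedgeL]
    simp only [h1, Finset.sum_add_distrib]
    rw [extD_eq, extD_eq]
    have h2 := wedgeTop_d₀ (α p) (β p)
    simp only [← wedgeTopL_apply, map_add, map_sum, FunLike.coe_add, Pi.add_apply,
      FunLike.coe_sum, Finset.sum_apply] at h2 ⊢
    rw [h2]
    ring
  have hs' : ∀ j, HasCompactSupport fun q => wedgeL j (β q) := fun j =>
    hs.comp_left (g := wedgeL j) (map_zero _)
  have hF : ∀ j, ContDiff ℝ 1 fun q => wedgeTop (parity (α q)) (wedgeL j (β q)) := fun j =>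
    (contDiff_wedgeTop hP (contDiff_lin _ hβ)).of_le (by exact_mod_cast le_top)
  rw [eq_neg_iff_add_eq_zero, ← integral_add
    (integrable_wedgeTop (contDiff_extD hα).continuous hβ.continuous hs)
    (integrable_wedgeTop hP.continuous (contDiff_extD hβ).continuous (hasCompactSupport_extD hs))]
  simp only [h0]
  rw [integral_finsetSum]
  · exact Finset.sum_eq_zero fun j _ =>
      integral_fderiv_frame j (hF j) (hasCompactSupport_wedgeTop _ (hs' j))
  · intro j _
    refine Continuous.integrable_of_hasCompactSupport
      (((hF j).continuous_fderiv one_ne_zero).clm_apply (contDiff_frame j).continuous) ?_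
    refine (hasCompactSupport_wedgeTop (fun q => parity (α q)) (hs' j)).mono' fun p hp => ?_
    by_contra h
    refine hp ?_
    have : fderiv ℝ (fun q => wedgeTop (parity (α q)) (wedgeL j (β q))) p = 0 := by
      by_contra h'
      exact h (support_fderiv_subset ℝ h')
    simp [this]

/-- The form `β` may be replaced by `Π_E β`, since the difference pairs to zero with `d Π_E α`. Then
`d` is integrated by parts, and `Π_E α` is replaced by `α` in the same way. The sign combines
`(-1)^m` from `parity` with the minus of the integration by parts. -/
theorem integral_wedgeTop_dc {m : ℕ} {α β : H n → Cov n} (hα : ContDiff ℝ (⊤ : ℕ∞) α)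
    (hβ : ContDiff ℝ (⊤ : ℕ∞) β) (hs : HasCompactSupport β) (hα' : ∀ p, α p ∈ E₀ n m)
    (hβ' : ∀ p, β p ∈ E₀all n) :
    ∫ p, wedgeTop (dc α p) (β p) = (-1) ^ (m + 1) * ∫ p, wedgeTop (α p) (dc β p) := by
  have h1 : ∀ p, wedgeTop (dc α p) (β p) = wedgeTop (extD (piE α) p) (piE β p) := by
    intro p
    rw [dc, wedgeTop_proj_left _ (hβ' p), piE, ← wedgeTopL_apply, ← wedgeTopL_apply, map_sub,
      wedgeTopL_apply _ (d₀inv n _), wedgeTop_d₀inv_right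
        (extD_piE_mem_orthogonal hα (fun q => (hα' q).2) p), sub_zero]
  have h2 : ∀ p, wedgeTop (parity (piE α p)) (extD (piE β) p) =
      (-1) ^ m * wedgeTop (α p) (dc β p) := by
    intro p
    rw [dc, wedgeTop_proj_right (hα' p).2, piE, map_sub, ← wedgeTopL_apply, map_sub,
      FunLike.coe_sub, Pi.sub_apply, wedgeTopL_apply (parity (d₀inv n _)),
      wedgeTop_parity_d₀inv_left (extD_piE_mem_orthogonal hβ hβ' p), sub_zero,
      parity_of_mem_covDeg (hα' p).1]
    simp
  simp only [h1]
  rw [integral_wedgeTop_extD (contDiff_piE hα) (contDiff_piE hβ) (hasCompactSupport_piE hs)]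
  simp only [h2]
  rw [integral_const_mul]
  ring

/-! ### The Heisenberg group -/

/-- The bilinear form in the group law. -/
def twist (p : H n) : H n →L[ℝ] ℝ :=
  (1 / 2 : ℝ) • ∑ k : Fin n,
    (p (ix k) • EuclideanSpace.proj (iy k) - p (iy k) • EuclideanSpace.proj (ix k))

theorem twist_apply (p q : H n) :
    twist p q = (1 / 2 : ℝ) * ∑ k : Fin n, (p (ix k) * q (iy k) - p (iy k) * q (ix k)) := by
  simp only [twist, FunLike.coe_sum, Finset.sum_apply, FunLike.coe_sub, Pi.sub_apply,
    FunLike.coe_smul, Pi.smul_apply, smul_eq_mul]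
  rfl

theorem gmul_eq (p q : H n) :
    gmul p q = p + q + twist p q • EuclideanSpace.single (it n) (1 : ℝ) := by
  rw [gmul, twist_apply]
  congr 1
  ext i
  simp

theorem twist_comm (p q : H n) : twist p q = -twist q p := by
  rw [twist_apply, twist_apply, ← mul_neg, ← Finset.sum_neg_distrib]
  congr 1
  exact Finset.sum_congr rfl fun k _ => by ring

theorem twist_self (p : H n) : twist p p = 0 := by
  rw [twist_apply]
  simp [mul_comm]

theorem twist_single_it (p : H n) : twist p (EuclideanSpace.single (it n) (1 : ℝ)) = 0 := by
  simp [twist_apply, ix_ne_it, iy_ne_it]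

theorem twist_gmul_right (p q r : H n) : twist p (gmul q r) = twist p q + twist p r := by
  rw [gmul_eq, map_add, map_add, map_smul, twist_single_it]
  simp

theorem twist_gmul_left (p q r : H n) : twist (gmul p q) r = twist p r + twist q r := by
  rw [twist_comm, twist_gmul_right, twist_comm r p, twist_comm r q]
  ring

/-- The group law is written multiplicatively beside the additive structure of `ℝ^(2n+1)`, so that
invariant measure and translation arguments apply to it. -/
instance : Group (H n) where
  mul := gmul
  one := 0
  inv p := -p
  mul_assoc p q r := by
    change gmul (gmul p q) r = gmul p (gmul q r)
    rw [gmul_eq (gmul p q), gmul_eq p (gmul q r), twist_gmul_left, twist_gmul_right, gmul_eq p q,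
      gmul_eq q r]
    module
  one_mul p := by
    change gmul 0 p = p
    rw [gmul_eq, twist_comm]
    simp
  mul_one p := by
    change gmul p 0 = p
    rw [gmul_eq]
    simp
  inv_mul_cancel p := by
    change gmul (-p) p = 0
    rw [gmul_eq, twist_comm, map_neg, twist_self]
    simp

theorem mul_eq (p q : H n) :
    p * q = p + q + twist p q • EuclideanSpace.single (it n) (1 : ℝ) := gmul_eq p q

theorem inv_eq (p : H n) : p⁻¹ = -p := rfl

theorem contDiff_mul : ContDiff ℝ (⊤ : ℕ∞) fun z : H n × H n => z.1 * z.2 := by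
  have : (fun z : H n × H n => z.1 * z.2) = fun z => z.1 + z.2 +
      ((1 / 2 : ℝ) * ∑ k : Fin n, (z.1 (ix k) * z.2 (iy k) - z.1 (iy k) * z.2 (ix k))) •
        EuclideanSpace.single (it n) (1 : ℝ) := by
    funext z
    rw [mul_eq, twist_apply]
  rw [this]
  fun_prop

instance : IsTopologicalGroup (H n) where
  continuous_mul := contDiff_mul.continuous
  continuous_inv := continuous_neg

/-- The linear part of the left translation by `p`. -/
def mulLin (p : H n) : H n →L[ℝ] H n :=
  ContinuousLinearMap.id ℝ _ + (twist p).smulRight (EuclideanSpace.single (it n) (1 : ℝ))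

theorem mul_eq_add_mulLin (p q : H n) : p * q = p + mulLin p q := by
  simp [mul_eq, mulLin, add_assoc]

/-- The linear part of a left translation is a transvection in the direction `t`, hence of
determinant 1. -/
theorem measurePreserving_mulLin (p : H n) : MeasurePreserving (mulLin p) := by
  refine ⟨(mulLin p).measurable, ?_⟩
  have h1 : (mulLin p : H n →ₗ[ℝ] H n) = LinearMap.transvection (twist p : H n →ₗ[ℝ] ℝ)
      (EuclideanSpace.single (it n) (1 : ℝ)) := by
    ext q
    simp [mulLin, LinearMap.transvection.apply]
  have h2 : LinearMap.det (mulLin p : H n →ₗ[ℝ] H n) = 1 := by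
    rw [h1, LinearMap.transvection.det]
    simp [twist_single_it]
  have := Measure.map_linearMap_addHaar_eq_smul_addHaar (volume : Measure (H n))
    (f := (mulLin p : H n →ₗ[ℝ] H n)) (by rw [h2]; exact one_ne_zero)
  simpa [h2] using this

instance : (volume : Measure (H n)).IsMulLeftInvariant where
  map_mul_left_eq_self p := by
    have : (fun q : H n => p * q) = (fun q => p + q) ∘ mulLin p := by
      funext q
      exact mul_eq_add_mulLin p q
    rw [this]
    exact ((measurePreserving_add_left volume p).comp (measurePreserving_mulLin p)).map_eq

instance : (volume : Measure (H n)).IsInvInvariant where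
  inv_eq_self := (Measure.measurePreserving_neg (volume : Measure (H n))).map_eq

theorem frameCoeff_eq_twist (j : Fin (2 * n + 1)) (p : H n) :
    frameCoeff j p = twist p (EuclideanSpace.single j (1 : ℝ)) := by
  rw [frameCoeff_apply, twist_apply, Finset.mul_sum]
  refine Finset.sum_congr rfl fun k _ => ?_
  by_cases h1 : j = ix k
  · subst h1
    simp [ix_ne_iy, (ix_ne_iy _ _).symm]
  · by_cases h2 : j = iy k
    · subst h2
      simp [ix_ne_iy, (ix_ne_iy _ _).symm]
    · simp [h1, h2, Ne.symm h1, Ne.symm h2]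

/-- Left invariance of the frame: `mulLin p` is the differential of the left translation by `p`. The
invariance of `d_c` rests on it. -/
theorem mulLin_frame (j : Fin (2 * n + 1)) (p q : H n) :
    mulLin p (frame j q) = frame j (p * q) := by
  have h : frameCoeff j (p * q) = frameCoeff j p + frameCoeff j q := by
    simp only [frameCoeff_eq_twist]
    exact twist_gmul_left p q _
  rw [frame_eq, frame_eq, h, mulLin]
  simp only [FunLike.coe_add, Pi.add_apply, ContinuousLinearMap.id_apply, map_add, map_smul,
    ContinuousLinearMap.smulRight_apply, twist_single_it, frameCoeff_eq_twist]
  simp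
  module

/-! ### Left invariance of `d_c` -/

theorem W_translate (j : Fin (2 * n + 1)) {α : H n → Cov n} (hα : Differentiable ℝ α) (y p : H n) :
    W j (fun q => α (y * q)) p = W j α (y * p) := by
  have h : HasFDerivAt (fun q : H n => y * q) (mulLin y) p := by
    simp only [mul_eq_add_mulLin]
    exact (mulLin y).hasFDerivAt.const_add y
  have h' : fderiv ℝ (fun q => α (y * q)) p = (fderiv ℝ α (y * p)).comp (mulLin y) :=
    ((hα (y * p)).hasFDerivAt.comp p h).fderiv
  rw [W, W, h', ← mulLin_frame]
  rfl

theorem d₁_translate {α : H n → Cov n} (hα : Differentiable ℝ α) (y p : H n) :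
    d₁ (fun q => α (y * q)) p = d₁ α (y * p) := by
  simp only [d₁, W_translate _ hα]

theorem dc_translate {α : H n → Cov n} (hα : ContDiff ℝ (⊤ : ℕ∞) α) (y p : H n) :
    dc (fun q => α (y * q)) p = dc α (y * p) := by
  have h : piE (fun q => α (y * q)) = fun q => piE α (y * q) := by
    funext q
    rw [piE, piE, d₁_translate (differentiable_of_contDiff hα)]
  have h' := differentiable_of_contDiff (contDiff_piE hα)
  rw [dc, dc, h, extD, extD, d₁_translate h', d₂, d₂, W_translate _ h']

/-! ### Left convolution with a test function -/

/-- The group convolution `η * χ`. -/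
def gconv (η : H n → ℝ) (χ : H n → Cov n) (x : H n) : Cov n :=
  ∫ y, η y • χ (y⁻¹ * x)

theorem gconv_eq (η : H n → ℝ) (χ : H n → Cov n) (x : H n) :
    gconv η χ x = ∫ z, η (x * z⁻¹) • χ z := by
  rw [gconv, ← integral_div_left_eq_self _ volume x]
  simp [div_eq_mul_inv]

theorem contDiff_gconv {η : H n → ℝ} {χ : H n → Cov n} (hη : ContDiff ℝ (⊤ : ℕ∞) η)
    (hs : HasCompactSupport η) (hχ : LocallyIntegrable χ) :
    ContDiff ℝ (⊤ : ℕ∞) (gconv η χ) := by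
  have h1 : ∀ R : ℝ, ContDiffOn ℝ (⊤ : ℕ∞) (gconv η χ) (Metric.ball 0 R) := by
    intro R
    have hk : IsCompact ((Metric.closedBall (0 : H n) R)⁻¹ * tsupport η) :=
      (isCompact_closedBall _ _).inv.mul hs
    -- The group convolution is an additive convolution evaluated at the fixed point 0, with `x` as
    -- a parameter of the kernel `η (x * z)`; the sign in `0 - z` supplies `z⁻¹`. Bounding `x` gives
    -- a compact set carrying all these kernels.
    have := contDiffOn_convolution_right_with_param_comp (𝕜 := ℝ) (n := (⊤ : ℕ∞))
      (μ := (volume : Measure (H n)))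
      (ContinuousLinearMap.lsmul ℝ ℝ : ℝ →L[ℝ] Cov n →L[ℝ] Cov n).flip
      (s := Metric.ball (0 : H n) R) (v := fun _ => (0 : H n)) contDiffOn_const (f := χ)
      (g := fun x z => η (x * z)) Metric.isOpen_ball hk ?_ hχ ?_
    · refine this.congr fun x _ => ?_
      rw [gconv_eq, convolution]
      refine integral_congr_ae (Filter.Eventually.of_forall fun z => ?_)
      simp [inv_eq]
    · intro x z hx hz
      by_contra h
      refine hz (Set.mem_mul.2 ⟨x⁻¹, ?_, x * z, subset_tsupport _ h, by simp⟩)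
      simpa using Metric.ball_subset_closedBall hx
    · exact (hη.comp contDiff_mul).contDiffOn
  rw [contDiff_iff_contDiffAt]
  intro x
  exact (h1 (‖x‖ + 1)).contDiffAt (Metric.isOpen_ball.mem_nhds (by simp))

theorem gconv_eq_zero {η : H n → ℝ} {χ : H n → Cov n} {K : Set (H n)} (hK : ∀ x ∉ K, χ x = 0)
    {x : H n} (hx : x ∉ tsupport η * K) : gconv η χ x = 0 := by
  rw [gconv, ← integral_zero (H n) (Cov n)]
  congr 1
  funext y
  by_cases hy : y ∈ tsupport η
  · rw [hK, smul_zero]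
    exact fun h => hx (Set.mem_mul.2 ⟨y, hy, y⁻¹ * x, h, by simp⟩)
  · rw [image_eq_zero_of_notMem_tsupport hy, zero_smul]

theorem tsupport_gconv_subset {η : H n → ℝ} {χ : H n → Cov n} {K : Set (H n)} (hc : IsCompact K)
    (hK : ∀ x ∉ K, χ x = 0) (hs : HasCompactSupport η) :
    tsupport (gconv η χ) ⊆ tsupport η * K :=
  closure_minimal (fun _ hx => by_contra fun h => hx (gconv_eq_zero hK h))
    (hs.isCompact.mul hc).isClosed

theorem integral_mem_submodule {X : Type*} [MeasurableSpace X] {μ : Measure X}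
    (S : Submodule ℝ (Cov n)) {f : X → Cov n} (hf : ∀ x, f x ∈ S) : ∫ x, f x ∂μ ∈ S := by
  by_cases hi : Integrable f μ
  · have h : ∫ x, f x ∂μ = S.starProjection (∫ x, f x ∂μ) := by
      rw [← ContinuousLinearMap.integral_comp_comm _ hi]
      simp only [fun x => Submodule.starProjection_eq_self_iff.2 (hf x)]
    rw [h]
    exact Submodule.starProjection_apply_mem _ _
  · rw [integral_undef hi]
    exact zero_mem _

theorem gconv_mem (S : Submodule ℝ (Cov n)) (η : H n → ℝ) {χ : H n → Cov n}
    (hχ : ∀ x, χ x ∈ S) (x : H n) : gconv η χ x ∈ S :=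
  integral_mem_submodule S fun _ => S.smul_mem _ (hχ _)

/-- The change of variables `y = x z⁻¹` turns `η(y) χ(y⁻¹x)` into `η(xz⁻¹) χ(z)`, for which joint
integrability is visible. -/
theorem measurePreserving_prod_div_left :
    MeasurePreserving (fun w : H n × H n => (w.1, w.1 * w.2⁻¹))
      ((volume : Measure (H n)).prod volume) ((volume : Measure (H n)).prod volume) := by
  refine (MeasurePreserving.id volume).skew_product (g := fun x z : H n => x * z⁻¹) ?_ ?_
  · exact (measurable_fst.mul measurable_snd.inv)
  · refine Filter.Eventually.of_forall fun x => ?_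
    simpa [div_eq_mul_inv] using
      (Measure.measurePreserving_div_left (volume : Measure (H n)) x).map_eq

theorem integral_bilin_gconv (B : Cov n →L[ℝ] Cov n →L[ℝ] ℝ) {η : H n → ℝ}
    {χ ω : H n → Cov n} {K : Set (H n)} (hη : Continuous η) (hs : HasCompactSupport η)
    (hK : IsCompact K) (hχK : ∀ x ∉ K, χ x = 0) (hχm : StronglyMeasurable χ)
    (hχ : Integrable χ) (hωm : StronglyMeasurable ω) (hω : LocallyIntegrable ω) :
    ∫ x, B (ω x) (gconv η χ x) = ∫ y, η y * ∫ x, B (ω x) (χ (y⁻¹ * x)) := by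
  obtain ⟨C, hC⟩ := hη.bounded_above_of_compact_support hs
  -- Only the values of `ω` on this compact set enter, so local integrability of `ω` is enough for
  -- Fubini.
  set Q : Set (H n) := tsupport η * K with hQ
  have hQc : IsCompact Q := hs.isCompact.mul hK
  have hωQ : Integrable (Q.indicator ω) :=
    (hω.integrableOn_isCompact hQc).integrable_indicator hQc.isClosed.measurableSet
  have hχ' : ∀ x, Integrable fun z => η (x * z⁻¹) • χ z := by
    intro x
    refine Integrable.bdd_smul (𝕜 := ℝ) (C := C) (f := χ) hχ ?_ ?_
    · exact (hη.comp (by fun_prop)).aestronglyMeasurable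
    · exact Filter.Eventually.of_forall fun z => hC _
  have hm : StronglyMeasurable fun w : H n × H n => η w.2 * B (ω w.1) (χ (w.2⁻¹ * w.1)) := by
    have h1 : StronglyMeasurable fun w : H n × H n => ω w.1 := hωm.comp_measurable measurable_fst
    have h2 : StronglyMeasurable fun w : H n × H n => χ (w.2⁻¹ * w.1) :=
      hχm.comp_measurable (measurable_snd.inv.mul measurable_fst)
    have h3 : StronglyMeasurable fun w : H n × H n => η w.2 :=
      (hη.comp continuous_snd).stronglyMeasurable
    exact h3.mul (B.continuous₂.comp_stronglyMeasurable (h1.prodMk h2))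
  have hint : Integrable (fun w : H n × H n => η w.2 * B (ω w.1) (χ (w.2⁻¹ * w.1)))
      ((volume : Measure (H n)).prod volume) := by
    rw [← measurePreserving_prod_div_left.integrable_comp hm.aestronglyMeasurable]
    refine ((hωQ.norm.mul_prod hχ.norm).const_mul (C * ‖B‖)).mono'
      (hm.comp_measurable measurePreserving_prod_div_left.measurable).aestronglyMeasurable
      (Filter.Eventually.of_forall fun w => ?_)
    have hC0 : 0 ≤ C := (norm_nonneg _).trans (hC 1)
    simp only [Function.comp_apply, mul_inv_rev, inv_inv, inv_mul_cancel_right, norm_mul]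
    by_cases hw : w.1 ∈ Q
    · rw [Set.indicator_of_mem hw, mul_assoc]
      refine mul_le_mul (hC _) ?_ (norm_nonneg _) hC0
      rw [← mul_assoc]
      exact B.le_opNorm₂ _ _
    · by_cases hz : w.2 ∈ K
      · have : η (w.1 * w.2⁻¹) = 0 := by
          by_contra h
          exact hw (Set.mem_mul.2 ⟨_, subset_tsupport _ h, _, hz, by simp⟩)
        rw [this, norm_zero, zero_mul]
        positivity
      · rw [hχK _ hz, map_zero, norm_zero, mul_zero]
        positivity
  have h1 : ∀ x, B (ω x) (gconv η χ x) = ∫ y, η y * B (ω x) (χ (y⁻¹ * x)) := by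
    intro x
    rw [gconv_eq, ← ContinuousLinearMap.integral_comp_comm _ (hχ' x),
      ← integral_div_left_eq_self (fun y => η y * B (ω x) (χ (y⁻¹ * x))) volume x]
    simp [div_eq_mul_inv]
  simp only [h1]
  rw [integral_integral_swap hint]
  simp only [integral_const_mul]

/-- Translations act strongly continuously on `L^q` for `q < ∞`, and the Hölder pairing with `ω` is
continuous on `L^q`. -/
theorem continuous_integral_bilin_translate (B : Cov n →L[ℝ] Cov n →L[ℝ] ℝ) {p q : ℝ≥0∞}
    [p.HolderConjugate q] (hq : q ≠ ∞) {χ ω : H n → Cov n} (hω : MemLp ω p) (hχ : MemLp χ q) :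
    Continuous fun y => ∫ x, B (ω x) (χ (y⁻¹ * x)) := by
  have : Fact (1 ≤ p) := ⟨ENNReal.HolderConjugate.one_le p q⟩
  have : Fact (1 ≤ q) := ⟨ENNReal.HolderConjugate.one_le q p⟩
  have : Fact (q ≠ ∞) := ⟨hq⟩
  have h : ∀ y : H n, ∫ x, B (ω x) (χ (y⁻¹ * x)) =
      B.lpPairing volume p q hω.toLp (DomMulAct.mk y⁻¹ • hχ.toLp) := by
    intro y
    rw [ContinuousLinearMap.lpPairing_eq_integral, DomMulAct.mk_smul_toLp]
    refine integral_congr_ae ?_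
    filter_upwards [hω.coeFn_toLp, MemLp.coeFn_toLp
      (hχ.comp_measurePreserving (measurePreserving_smul y⁻¹ volume))] with x h1 h2
    rw [h1]
    exact congrArg _ h2.symm
  simp only [h]
  refine (ContinuousLinearMap.continuous _).comp ?_
  exact (DomMulAct.continuous_mk.comp continuous_inv).smul continuous_const

/-! ### Closed forms are orthogonal to exact forms -/

/-- Testing `γ = d_c(η * χ)` against its own Hodge dual gives `∫ |γ|²`. Integration by parts and
Fubini turn this into an average over `y` of pairings of `χ` with `d_c` of left translates of a
smooth form, all zero by weak closedness. -/
theorem dc_gconv_eq_zero {m : ℕ} (hm : m ≤ 2 * n) {χ : H n → Cov n} {K : Set (H n)}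
    (hK : IsCompact K) (hχK : ∀ x ∉ K, χ x = 0) (hχm : StronglyMeasurable χ) (hχ : Integrable χ)
    (hχE : ∀ x, χ x ∈ E₀ n m)
    (hcl : ∀ β : H n → Cov n, ContDiff ℝ (⊤ : ℕ∞) β → HasCompactSupport β →
      (∀ x, β x ∈ E₀ n (2 * n - m)) → ∫ x, wedgeTop (χ x) (dc β x) = 0)
    {η : H n → ℝ} (hη : ContDiff ℝ (⊤ : ℕ∞) η) (hs : HasCompactSupport η) (x : H n) :
    dc (gconv η χ) x = 0 := by
  have hsm := contDiff_gconv hη hs hχ.locallyIntegrable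
  have hcs : HasCompactSupport (gconv η χ) :=
    (hs.isCompact.mul hK).of_isClosed_subset (isClosed_tsupport _)
      (tsupport_gconv_subset hK hχK hs)
  set γ := dc (gconv η χ) with hγ
  have hγsm : ContDiff ℝ (⊤ : ℕ∞) γ := contDiff_dc hsm
  set β : H n → Cov n := fun x => star (γ x) with hβ
  have hβsm : ContDiff ℝ (⊤ : ℕ∞) β :=
    contDiff_lin (star (n := n)).toLinearEquiv.toLinearMap hγsm
  have hβcs : HasCompactSupport β := (hasCompactSupport_dc hcs).comp_left (map_zero star)
  have hβE : ∀ x, β x ∈ E₀ n (2 * n - m) := by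
    intro x
    have := star_mem_E₀ (by omega) (dc_mem_E₀ hsm (gconv_mem _ η hχE) x)
    rwa [show 2 * n + 1 - (m + 1) = 2 * n - m by omega] at this
  have hdβ : Continuous (dc β) := (contDiff_dc hβsm).continuous
  have h1 : ∫ x, wedgeTop (gconv η χ x) (dc β x) = 0 := by
    have h2 := integral_bilin_gconv wedgeTopL.flip hη.continuous hs hK hχK hχm hχ
      hdβ.stronglyMeasurable hdβ.locallyIntegrable
    simp only [ContinuousLinearMap.flip_apply, wedgeTopL_apply] at h2
    rw [h2, ← integral_zero (H n) ℝ]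
    congr 1
    funext y
    -- The substitution `x ↦ y x` moves the translation from `χ` to the smooth form, where it
    -- commutes with `d_c`.
    rw [← integral_mul_left_eq_self _ y]
    simp only [inv_mul_cancel_left, ← dc_translate hβsm]
    rw [hcl (fun q => β (y * q))
      (hβsm.comp (contDiff_mul.comp (contDiff_const.prodMk contDiff_id)))
      (hβcs.comp_homeomorph (Homeomorph.mulLeft y)) fun x => hβE _, mul_zero]
  have h2 := integral_wedgeTop_dc hsm hβsm hβcs (gconv_mem _ η hχE) fun x => (hβE x).2
  rw [h1, mul_zero] at h2
  have h3 : ∀ x, wedgeTop (γ x) (β x) = ‖γ x‖ ^ 2 := by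
    intro x
    rw [wedgeTop_eq_inner, inner_star_star, real_inner_self_eq_norm_sq]
  simp only [← hγ, h3] at h2
  by_contra hx
  refine (Continuous.integral_pos_of_hasCompactSupport_nonneg_nonzero (μ := volume)
    (f := fun x => ‖γ x‖ ^ 2) (hγsm.continuous.norm.pow 2) ?_ (fun x => by positivity)
    (x := x) (by simpa using hx)).ne' h2
  exact (hasCompactSupport_dc hcs).comp_left (g := fun v : Cov n => ‖v‖ ^ 2) (by simp)

theorem exists_cutoff {K : Set (H n)} (hK : IsCompact K) {V : Opens (H n)} (hKV : K ⊆ V) :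
    ∃ κ : H n → ℝ, ContDiff ℝ (⊤ : ℕ∞) κ ∧ HasCompactSupport κ ∧ tsupport κ ⊆ V ∧
      ∀ x ∈ K, κ =ᶠ[nhds x] fun _ => 1 := by
  obtain ⟨L, hL, hKL, hLV⟩ := exists_compact_between hK V.isOpen hKV
  obtain ⟨f, hf1, hf0, -⟩ := exists_contMDiffMap_one_nhds_of_subset_interior
    (modelWithCornersSelf ℝ (H n)) (n := (⊤ : ℕ∞)) hK.isClosed hKL
  have hsupp : tsupport f ⊆ L := closure_minimal
    (fun x hx => by_contra fun h => hx (hf0 x h)) hL.isClosed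
  refine ⟨f, f.contMDiff.contDiff, hL.of_isClosed_subset (isClosed_tsupport _) hsupp,
    hsupp.trans hLV, fun x hx => ?_⟩
  exact Filter.eventually_of_mem (Filter.mem_of_superset
    (nhds_le_nhdsSet hx hf1) fun _ h => h) fun _ h => h

/-- A cutoff equal to 1 near `K` changes neither `β` nor `d_c β` where `χ` lives. This is needed
because the translated forms used to test `η * χ` need not be supported in `V`. -/
theorem integral_wedgeTop_dc_eq_zero_of_testForms {k : ℕ} {V : Opens (H n)} {χ : H n → Cov n}
    {K : Set (H n)} (hK : IsCompact K) (hKV : K ⊆ V) (hχK : ∀ x ∉ K, χ x = 0)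
    (hcl : ∀ β : 𝓓(V, Cov n), IsTestForm k β → ∫ x in (V : Set (H n)),
      wedgeTop (χ x) (dc β x) = 0)
    {β : H n → Cov n} (hβ : ContDiff ℝ (⊤ : ℕ∞) β) (hβE : ∀ x, β x ∈ E₀ n k) :
    ∫ x, wedgeTop (χ x) (dc β x) = 0 := by
  obtain ⟨κ, hκ, hκs, hκV, hκ1⟩ := exists_cutoff hK hKV
  let b : 𝓓(V, Cov n) :=
    { toFun := fun x => κ x • β x
      contDiff' := hκ.smul hβ
      hasCompactSupport' := hκs.smul_right
      tsupport_subset' := (closure_mono (Function.support_smul_subset_left κ β)).trans hκV }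
  have hb := hcl b fun x => (E₀ n k).smul_mem _ (hβE x)
  rw [← hb, setIntegral_eq_integral_of_forall_compl_eq_zero]
  · congr 1
    funext x
    by_cases hx : x ∈ K
    · have : (fun x => κ x • β x) =ᶠ[nhds x] β := by
        filter_upwards [hκ1 x hx] with y hy
        rw [hy, one_smul]
      exact congrArg _ (dc_congr this).symm
    · simp [hχK x hx, ← wedgeTopL_apply]
  · intro x hx
    simp [hχK x fun h => hx (hKV h), ← wedgeTopL_apply]

/-- The distribution `T` cannot be applied to `d_c χ` directly, so `χ` is smoothed. The function
`F(y) = ∫ ω(x) ∧ χ(y⁻¹x) dx` is continuous and integrates to zero against every `η` supported near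
the identity; its value at the identity is the integral sought. -/
theorem integral_wedgeTop_eq_zero_of_closed {h : ℕ} (h1 : 1 ≤ h) (h2 : h ≤ 2 * n + 1)
    {p q : ℝ≥0∞} [p.HolderConjugate q] (hq : q ≠ ∞) {V : Opens (H n)} {χ ω : H n → Cov n}
    {K : Set (H n)} (hωm : StronglyMeasurable ω) (hω : MemLp ω p) (hωV : ∀ x ∉ V, ω x = 0)
    (hex : IsDcExact h V ω)
    (hK : IsCompact K) (hKV : K ⊆ V) (hχK : ∀ x ∉ K, χ x = 0) (hχm : StronglyMeasurable χ)
    (hχ : MemLp χ q) (hχE : ∀ x, χ x ∈ E₀ n (2 * n + 1 - h))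
    (hcl : ∀ β : 𝓓(V, Cov n), IsTestForm (h - 1) β → ∫ x in (V : Set (H n)),
      wedgeTop (χ x) (dc β x) = 0) :
    ∫ x, wedgeTop (ω x) (χ x) = 0 := by
  obtain ⟨T, hT⟩ := hex
  have hp1 : 1 ≤ p := ENNReal.HolderConjugate.one_le p q
  have hq1 : 1 ≤ q := ENNReal.HolderConjugate.one_le q p
  have hχi : Integrable χ := by
    have := (hχ.locallyIntegrable hq1).integrableOn_isCompact hK
    rwa [integrableOn_iff_integrable_of_support_subset] at this
    exact fun x hx => by_contra fun h => hx (hχK x h)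
  -- Since `N * K ⊆ V`, the smoothed form stays an admissible test form for `T` when `η` is
  -- supported in `N`.
  obtain ⟨N, hN, hNK⟩ := compact_open_separated_mul_left hK V.isOpen hKV
  set F : H n → ℝ := fun y => ∫ x, wedgeTop (ω x) (χ (y⁻¹ * x)) with hF
  have hFc : Continuous F := by
    simpa using continuous_integral_bilin_translate wedgeTopL hq hω hχ
  have hFη : ∀ η : H n → ℝ, ContDiff ℝ (⊤ : ℕ∞) η → HasCompactSupport η →
      tsupport η ⊆ interior N → ∫ y, η y • F y = 0 := by
    intro η hη hs hηN
    have hsm := contDiff_gconv hη hs hχi.locallyIntegrable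
    have hsub := tsupport_gconv_subset hK hχK hs
    let a : 𝓓(V, Cov n) :=
      { toFun := gconv η χ
        contDiff' := hsm
        hasCompactSupport' := (hs.isCompact.mul hK).of_isClosed_subset (isClosed_tsupport _) hsub
        tsupport_subset' := hsub.trans
          ((Set.mul_subset_mul_right (hηN.trans interior_subset)).trans hNK) }
    have ha0 : dcTest a = 0 := by
      ext1 x
      refine dc_gconv_eq_zero (m := 2 * n + 1 - h) (by omega) hK hχK hχm hχi hχE ?_ hη hs x
      intro β hβ _ hβE
      rw [show 2 * n - (2 * n + 1 - h) = h - 1 by omega] at hβE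
      exact integral_wedgeTop_dc_eq_zero_of_testForms hK hKV hχK hcl hβ hβE
    have h3 := hT a (gconv_mem _ η hχE)
    rw [ha0, map_zero, mul_zero, setIntegral_eq_integral_of_forall_compl_eq_zero
      (fun x hx => by simp [hωV x hx, ← wedgeTopL_apply])] at h3
    have h4 := integral_bilin_gconv wedgeTopL hη.continuous hs hK hχK hχm hχi hωm
      (hω.locallyIntegrable hp1)
    simp only [wedgeTopL_apply] at h4
    rw [← h3]
    exact h4.symm
  have hF0 := isOpen_interior.ae_eq_zero_of_integral_contDiff_smul_eq_zero (μ := volume)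
    (hFc.locallyIntegrable.locallyIntegrableOn _) hFη
  -- A continuous function vanishing almost everywhere on an open set vanishes at each of its
  -- points.
  have h5 : F 1 = 0 := by
    by_contra hne
    have ho : IsOpen (interior N ∩ {y | F y ≠ 0}) :=
      isOpen_interior.inter (isOpen_ne_fun hFc continuous_const)
    refine (ho.measure_pos volume ⟨1, mem_interior_iff_mem_nhds.2 hN, hne⟩).ne' ?_
    refine measure_mono_null ?_ (ae_iff.1 hF0)
    rintro x ⟨hx1, hx2⟩ h
    exact hx2 (h hx1)
  simpa [hF] using h5

/-- The data are replaced by representatives with pointwise properties: `ω` vanishes off `V`, and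
`χ` vanishes off `K` and is `E₀`-valued everywhere. -/
theorem setIntegral_wedgeTop_eq_zero_of_closed {h : ℕ} (h1 : 1 ≤ h) (h2 : h ≤ 2 * n + 1)
    {p q : ℝ≥0∞} [p.HolderConjugate q] (hq : q ≠ ∞) {V : Opens (H n)} {χ ω : H n → Cov n}
    (hω : IsLpForm h p V ω) (hex : IsDcExact h V ω)
    (hχ : IsLpForm (2 * n + 1 - h) q V χ) (hχs : CompactlySupportedIn V χ)
    (hcl : ∀ β : 𝓓(V, Cov n), IsTestForm (h - 1) β → ∫ x in (V : Set (H n)),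
      wedgeTop (χ x) (dc β x) = 0) :
    ∫ x in (V : Set (H n)), wedgeTop (ω x) (χ x) = 0 := by
  obtain ⟨K, hK, hKV, hK0⟩ := hχs
  have hVm : MeasurableSet (V : Set (H n)) := V.isOpen.measurableSet
  set ω' := (V : Set (H n)).indicator (hω.memLp.1.mk ω) with hω'
  have hωω' : ω' =ᵐ[volume.restrict (V : Set (H n))] ω :=
    (indicator_ae_eq_restrict hVm).trans hω.memLp.1.ae_eq_mk.symm
  set χ' : H n → Cov n := K.indicator fun x =>
    (E₀ n (2 * n + 1 - h)).starProjection (hχ.memLp.1.mk χ x) with hχ'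
  have hχχ' : χ' =ᵐ[volume.restrict (V : Set (H n))] χ := by
    filter_upwards [hχ.memLp.1.ae_eq_mk, hχ.mem_E₀, hK0] with x hx1 hx2 hx3
    by_cases hx : x ∈ K
    · rw [hχ', Set.indicator_of_mem hx, ← hx1, Submodule.starProjection_eq_self_iff.2 hx2]
    · rw [hχ', Set.indicator_of_notMem hx, hx3 hx]
  have hmem : ∀ {f : H n → Cov n} {r : ℝ≥0∞}, (∀ x ∉ (V : Set (H n)), f x = 0) →
      MemLp f r (volume.restrict (V : Set (H n))) → MemLp f r := by
    intro f r hf hf'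
    rw [← memLp_indicator_iff_restrict hVm] at hf'
    rwa [Set.indicator_eq_self.2 fun x hx => by_contra fun h => hx (hf x h)] at hf'
  have hω0 : ∀ x ∉ (V : Set (H n)), ω' x = 0 := fun x hx => Set.indicator_of_notMem hx _
  have hχ0 : ∀ x ∉ K, χ' x = 0 := fun x hx => Set.indicator_of_notMem hx _
  have key := integral_wedgeTop_eq_zero_of_closed h1 h2 (p := p) hq (V := V) (ω := ω') (χ := χ')
    (hω.memLp.1.stronglyMeasurable_mk.indicator hVm)
    (hmem hω0 (hω.memLp.ae_eq hωω'.symm)) hω0 ?_ hK hKV hχ0 ?_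
    (hmem (fun x hx => hχ0 x fun h => hx (hKV h)) (hχ.memLp.ae_eq hχχ'.symm)) ?_ ?_
  · rw [← setIntegral_eq_integral_of_forall_compl_eq_zero (s := (V : Set (H n)))
      (fun x hx => by simp [hω0 x hx, ← wedgeTopL_apply])] at key
    rw [← key]
    refine integral_congr_ae ?_
    filter_upwards [hωω', hχχ'] with x hx1 hx2
    rw [hx1, hx2]
  · obtain ⟨T, hT⟩ := hex
    refine ⟨T, fun α hα => ?_⟩
    rw [← hT α hα]
    refine integral_congr_ae ?_
    filter_upwards [hωω'] with x hx1
    rw [hx1]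
  · exact ((E₀ n (2 * n + 1 - h)).starProjection.continuous.comp_stronglyMeasurable
      hχ.memLp.1.stronglyMeasurable_mk).indicator hK.isClosed.measurableSet
  · intro x
    rw [hχ']
    by_cases hx : x ∈ K
    · rw [Set.indicator_of_mem hx]
      exact Submodule.starProjection_apply_mem _ _
    · rw [Set.indicator_of_notMem hx]
      exact zero_mem _
  · intro β hβ
    rw [← hcl β hβ]
    refine integral_congr_ae ?_
    filter_upwards [hχχ'] with x hx
    rw [hx]

/-! ### Bounded functionals on a space of integrable functions -/

theorem integral_mul_norm_le {X E : Type*} [MeasurableSpace X] {μ : Measure X}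
    [NormedAddCommGroup E] {w : X → ℝ} (hw : MemLp w 2 μ) (f : Lp E 2 μ) :
    ∫ x, w x * ‖f x‖ ∂μ ≤ ‖hw.toLp‖ * ‖f‖ := by
  have h := real_inner_le_norm hw.toLp (Lp.memLp f).norm.toLp
  have h1 : ‖(Lp.memLp f).norm.toLp‖ = ‖f‖ := by
    rw [Lp.norm_toLp, eLpNorm_norm, Lp.norm_def]
  rw [h1, L2.inner_def] at h
  refine le_trans (le_of_eq (integral_congr_ae ?_)) h
  filter_upwards [hw.coeFn_toLp, (Lp.memLp f).norm.coeFn_toLp] with x hx1 hx2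
  rw [hx1, hx2]
  simp [mul_comm]

section Representation

variable {X E S : Type*} [MeasurableSpace X] {μ : Measure X} [NormedAddCommGroup E]
  [InnerProductSpace ℝ E] [CompleteSpace E] [AddCommGroup S] [Module ℝ S]

/-- The Riesz vector `u` is tested against `u` itself on `D = {|u| > M w}`. This gives `∫_D |u|² ≤ M
∫_D w |u|`, which forces `D` to be null. -/
theorem exists_inner_representation {w : X → ℝ} (hw0 : ∀ x, 0 < w x) (hwm : Measurable w)
    (hw : MemLp w 2 μ) {M : ℝ} (hM : 0 ≤ M) (g : Lp E 2 μ →ₗ[ℝ] ℝ)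
    (hg : ∀ f : Lp E 2 μ, g f ≤ M * ∫ x, w x * ‖f x‖ ∂μ) :
    ∃ u : Lp E 2 μ, (∀ f, g f = inner ℝ u f) ∧ ∀ᵐ x ∂μ, ‖u x‖ ≤ M * w x := by
  have hbound : ∀ f, ‖g f‖ ≤ M * ‖hw.toLp‖ * ‖f‖ := by
    intro f
    have h1 : ∀ f, g f ≤ M * ‖hw.toLp‖ * ‖f‖ := fun f => (hg f).trans (by
      rw [mul_assoc]
      exact mul_le_mul_of_nonneg_left (integral_mul_norm_le hw f) hM)
    rw [Real.norm_eq_abs, abs_le]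
    refine ⟨?_, h1 f⟩
    have := h1 (-f)
    rw [map_neg, norm_neg] at this
    linarith
  set gc : StrongDual ℝ (Lp E 2 μ) := g.mkContinuous _ hbound with hgc
  set u : Lp E 2 μ := (InnerProductSpace.toDual ℝ (Lp E 2 μ)).symm gc with hu
  have hgu : ∀ f, g f = inner ℝ u f := by
    intro f
    rw [hu, InnerProductSpace.toDual_symm_apply]
    rfl
  refine ⟨u, hgu, ?_⟩
  set D : Set X := {x | M * w x < ‖u x‖} with hD
  have hum : Measurable fun x => ‖u x‖ := (Lp.stronglyMeasurable u).norm.measurable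
  have hDm : MeasurableSet D := measurableSet_lt (hwm.const_mul M) hum
  have hDu : MemLp (D.indicator u) 2 μ := (Lp.memLp u).indicator hDm
  have hi1 : Integrable (fun x => ‖u x‖ ^ 2) μ := (Lp.memLp u).integrable_norm_pow two_ne_zero
  have hi2 : Integrable (fun x => w x * ‖u x‖) μ := hw.integrable_mul (Lp.memLp u).norm
  have h1 : g hDu.toLp = ∫ x, D.indicator (fun x => ‖u x‖ ^ 2) x ∂μ := by
    rw [hgu, L2.inner_def]
    refine integral_congr_ae ?_
    filter_upwards [hDu.coeFn_toLp] with x hx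
    rw [hx]
    by_cases hxD : x ∈ D
    · simp [hxD]
    · simp [hxD]
  have h2 : ∫ x, w x * ‖(hDu.toLp : Lp E 2 μ) x‖ ∂μ = ∫ x, D.indicator (fun x => w x * ‖u x‖) x ∂μ := by
    refine integral_congr_ae ?_
    filter_upwards [hDu.coeFn_toLp] with x hx
    rw [hx]
    by_cases hxD : x ∈ D
    · simp [hxD]
    · simp [hxD]
  have h3 := hg hDu.toLp
  rw [h1, h2, ← integral_const_mul, ← sub_nonpos, ← integral_sub (hi1.indicator hDm)
    ((hi2.indicator hDm).const_mul M)] at h3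
  have hnn : ∀ x, 0 ≤ D.indicator (fun x => ‖u x‖ ^ 2) x -
      M * D.indicator (fun x => w x * ‖u x‖) x := by
    intro x
    by_cases hx : x ∈ D
    · simp only [Set.indicator_of_mem hx]
      have : M * w x < ‖u x‖ := hx
      nlinarith [norm_nonneg (u x)]
    · simp [hx]
  have h4 := (integral_eq_zero_iff_of_nonneg hnn
    ((hi1.indicator hDm).sub ((hi2.indicator hDm).const_mul M))).1
      (le_antisymm h3 (integral_nonneg hnn))
  filter_upwards [h4] with x hx
  by_contra hlt
  have hxD : x ∈ D := not_le.1 hlt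
  simp only [Set.indicator_of_mem hxD, Pi.zero_apply] at hx
  have h5 : M * w x < ‖u x‖ := hxD
  have h6 : 0 ≤ M * w x := mul_nonneg hM (hw0 x).le
  nlinarith

/-- A form of `(L^1)* = L^∞` obtained inside `L²`. Division by the weight `w` sends the range of `A`
into `L²`, where the `L^1` norm becomes the sublinear functional `f ↦ ∫ w |f|`. Hahn-Banach extends
under it, Riesz represents the extension by some `u` with `|u| ≤ M w`, and `G = u / w`. -/
theorem exists_bounded_representation {w : X → ℝ} (hw0 : ∀ x, 0 < w x) (hwm : Measurable w)
    (hw : MemLp w 2 μ) {A : S → X → E} (hA_add : ∀ s t, A (s + t) = A s + A t)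
    (hA_smul : ∀ (c : ℝ) s, A (c • s) = c • A s)
    (hA : ∀ s, MemLp (fun x => (w x)⁻¹ • A s x) 2 μ) (l : S →ₗ[ℝ] ℝ) {M : ℝ} (hM : 0 ≤ M)
    (hl : ∀ s, |l s| ≤ M * ∫ x, ‖A s x‖ ∂μ) :
    ∃ G : X → E, AEStronglyMeasurable G μ ∧ (∀ᵐ x ∂μ, ‖G x‖ ≤ M) ∧
      ∀ s, l s = ∫ x, inner ℝ (G x) (A s x) ∂μ := by
  let a : S →ₗ[ℝ] Lp E 2 μ :=
    { toFun := fun s => (hA s).toLp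
      map_add' := fun s t => by
        rw [← MemLp.toLp_add]
        congr 1
        funext x
        simp [hA_add]
      map_smul' := fun c s => by
        rw [RingHom.id_apply, ← MemLp.toLp_const_smul]
        congr 1
        funext x
        rw [hA_smul, Pi.smul_apply, Pi.smul_apply, smul_comm] }
  have ha : ∀ s, a s =ᵐ[μ] fun x => (w x)⁻¹ • A s x := fun s => (hA s).coeFn_toLp
  have hnorm : ∀ s, ∫ x, w x * ‖a s x‖ ∂μ = ∫ x, ‖A s x‖ ∂μ := by
    intro s
    refine integral_congr_ae ?_
    filter_upwards [ha s] with x hx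
    rw [hx, norm_smul, norm_inv, Real.norm_of_nonneg (hw0 x).le,
      mul_inv_cancel_left₀ (hw0 x).ne']
  have hker : ∀ s, a s = 0 → l s = 0 := by
    intro s hs
    have h1 : ∫ x, w x * ‖a s x‖ ∂μ = 0 := by
      rw [hs, ← integral_zero X ℝ]
      refine integral_congr_ae ?_
      filter_upwards [Lp.coeFn_zero E 2 μ] with x hx
      change w x * ‖(0 : Lp E 2 μ) x‖ = 0
      rw [hx]
      simp
    have := hl s
    rw [← hnorm, h1, mul_zero] at this
    exact abs_nonpos_iff.1 this
  -- A linear section of `a` over its range: since `l` vanishes on `ker a`, `l ∘ σ` is the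
  -- functional induced by `l` on that range.
  obtain ⟨σ, hσ⟩ := a.rangeRestrict.exists_rightInverse_of_surjective a.range_rangeRestrict
  have hσ' : ∀ y, a (σ y) = y := fun y => congrArg Subtype.val (LinearMap.congr_fun hσ y)
  have hint : ∀ f : Lp E 2 μ, Integrable (fun x => w x * ‖f x‖) μ := fun f =>
    hw.integrable_mul (Lp.memLp f).norm
  let N : Lp E 2 μ → ℝ := fun f => M * ∫ x, w x * ‖f x‖ ∂μ
  have hN_smul : ∀ c : ℝ, 0 < c → ∀ f, N (c • f) = c * N f := by
    intro c hc f
    simp only [N]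
    rw [mul_left_comm, ← integral_const_mul c]
    congr 1
    refine integral_congr_ae ?_
    filter_upwards [Lp.coeFn_smul c f] with x hx
    rw [hx, Pi.smul_apply, norm_smul, Real.norm_of_nonneg hc.le]
    ring
  have hN_add : ∀ f f', N (f + f') ≤ N f + N f' := by
    intro f f'
    simp only [N]
    rw [← mul_add, ← integral_add (hint f) (hint f')]
    refine mul_le_mul_of_nonneg_left (integral_mono_ae (hint _) ((hint f).add (hint f')) ?_) hM
    filter_upwards [Lp.coeFn_add f f'] with x hx
    rw [hx, Pi.add_apply, ← mul_add]
    exact mul_le_mul_of_nonneg_left (norm_add_le _ _) (hw0 x).le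
  have hN : ∀ f : LinearMap.range a, (l ∘ₗ σ) f ≤ N f := by
    rintro ⟨f, hf⟩
    have h1 := hl (σ ⟨f, hf⟩)
    rw [← hnorm, hσ'] at h1
    exact (le_abs_self _).trans h1
  obtain ⟨g, hg1, hg2⟩ := exists_extension_of_le_sublinear ⟨LinearMap.range a, l ∘ₗ σ⟩ N
    hN_smul hN_add hN
  obtain ⟨u, hu1, hu2⟩ := exists_inner_representation hw0 hwm hw hM g hg2
  refine ⟨fun x => (w x)⁻¹ • u x, ?_, ?_, ?_⟩
  · exact hwm.inv.aestronglyMeasurable.smul (Lp.aestronglyMeasurable u)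
  · filter_upwards [hu2] with x hx
    rw [norm_smul, norm_inv, Real.norm_of_nonneg (hw0 x).le, inv_mul_le_iff₀ (hw0 x), mul_comm]
    exact hx
  · intro s
    have h1 : l s = g (a s) := by
      have h2 := hg1 ⟨a s, LinearMap.mem_range_self a s⟩
      have h3 := hker (σ ⟨a s, LinearMap.mem_range_self a s⟩ - s)
        (by rw [map_sub, hσ', sub_self])
      rw [map_sub, sub_eq_zero] at h3
      rw [← h3]
      exact h2.symm
    rw [h1, hu1, L2.inner_def]
    refine integral_congr_ae ?_
    filter_upwards [ha s] with x hx
    rw [hx, inner_smul_left, inner_smul_right]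
    rfl

end Representation

/-! ### Dual inequalities -/

theorem integrable_wedgeTop_of_memLp {p q : ℝ≥0∞} [p.HolderConjugate q] {μ : Measure (H n)}
    {ω ψ : H n → Cov n} (hω : MemLp ω p μ) (hψ : MemLp ψ q μ) :
    Integrable (fun x => wedgeTop (ω x) (ψ x)) μ := by
  simpa [memLp_one_iff_integrable] using wedgeTopL.memLp_of_bilin 1 hω hψ

theorem enorm_integral_wedgeTop_le {p q : ℝ≥0∞} [p.HolderConjugate q] {μ : Measure (H n)}
    {ω ψ : H n → Cov n} (hω : MemLp ω p μ) (hψ : MemLp ψ q μ) :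
    ‖∫ x, wedgeTop (ω x) (ψ x) ∂μ‖ₑ ≤ eLpNorm ω p μ * eLpNorm ψ q μ := by
  refine (enorm_integral_le_lintegral_enorm _).trans ?_
  rw [← eLpNorm_one_eq_lintegral_enorm]
  have := eLpNorm_le_eLpNorm_mul_eLpNorm_of_nnnorm (p := p) (q := q) (r := 1) hω.1 hψ.1 wedgeTop 1
    (Filter.Eventually.of_forall fun x => by
      rw [one_mul, ← NNReal.coe_le_coe]
      exact abs_wedgeTop_le _ _)
  simpa using this

theorem memLp_testFunction {V : Opens (H n)} {f : H n → Cov n} (hf : Continuous f)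
    (hs : HasCompactSupport f) (q : ℝ≥0∞) : MemLp f q (volume.restrict (V : Set (H n))) :=
  (hf.memLp_of_hasCompactSupport hs).restrict _

/-- The potential is the distribution `β ↦ ∫ α ∧ β`; it extends to bounded continuous functions,
where its continuity is the estimate by `‖α‖_1`. -/
theorem isDcExact_dc {m : ℕ} {U : Opens (H n)} (α : 𝓓(U, Cov n))
    (hα : IsTestForm m α) : IsDcExact (m + 1) U (dc α) := by
  have hi : Integrable α := α.continuous.integrable_of_hasCompactSupport α.hasCompactSupport
  have hb : ∀ f : BoundedContinuousFunction (H n) (Cov n),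
      Integrable fun x => wedgeTop (α x) (f x) := by
    intro f
    refine (hi.norm.mul_const ‖f‖).mono' ?_ (Filter.Eventually.of_forall fun x =>
      (abs_wedgeTop_le _ _).trans (mul_le_mul_of_nonneg_left (f.norm_coe_le_norm x)
        (norm_nonneg _)))
    simp only [← wedgeTopL_apply]
    exact (by fun_prop : Continuous fun x => wedgeTopL (α x) (f x)).aestronglyMeasurable
  let Tl : BoundedContinuousFunction (H n) (Cov n) →ₗ[ℝ] ℝ :=
    { toFun := fun f => ∫ x, wedgeTop (α x) (f x)
      map_add' := fun f g => by
        rw [← integral_add (hb f) (hb g)]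
        simp [← wedgeTopL_apply]
      map_smul' := fun c f => by
        rw [RingHom.id_apply, smul_eq_mul, ← integral_const_mul]
        simp [← wedgeTopL_apply] }
  let T := Tl.mkContinuous (∫ x, ‖α x‖) fun f => by
    rw [← integral_mul_const]
    refine norm_integral_le_of_norm_le (hi.norm.mul_const _)
      (Filter.Eventually.of_forall fun x => (abs_wedgeTop_le _ _).trans
        (mul_le_mul_of_nonneg_left (f.norm_coe_le_norm x) (norm_nonneg _)))
  refine ⟨T.comp (TestFunction.toBoundedContinuousFunctionCLM ℝ), fun β hβ => ?_⟩
  rw [setIntegral_eq_integral_of_forall_compl_eq_zero]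
  · exact integral_wedgeTop_dc α.contDiff β.contDiff β.hasCompactSupport hα fun x => (hβ x).2
  · intro x hx
    rw [image_eq_zero_of_notMem_tsupport fun h => hx (β.tsupport_subset h), ← wedgeTopL_apply,
      map_zero]

/-- The test forms of degree `m`. -/
def testForms (m : ℕ) (U : Opens (H n)) : Submodule ℝ (𝓓(U, Cov n)) where
  carrier := {α | IsTestForm m α}
  zero_mem' := fun _ => zero_mem _
  add_mem' := fun ha hb x => add_mem (ha x) (hb x)
  smul_mem' := fun c _ ha x => Submodule.smul_mem _ c (ha x)

theorem exists_weight (n : ℕ) :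
    ∃ w : H n → ℝ, (∀ x, 0 < w x) ∧ Continuous w ∧ MemLp w 2 := by
  have hc : Continuous fun x : H n => √((1 + ‖x‖) ^ (-(2 * n + 2 : ℝ))) := by
    refine Real.continuous_sqrt.comp (Continuous.rpow_const (by fun_prop) fun x => Or.inl ?_)
    positivity
  refine ⟨fun x => √((1 + ‖x‖) ^ (-(2 * n + 2 : ℝ))), fun x => by positivity, hc, ?_⟩
  rw [memLp_two_iff_integrable_sq hc.aestronglyMeasurable]
  -- The exponent `2n + 2` exceeds the dimension `2n + 1`, so the square of the weight is
  -- integrable.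
  have := integrable_one_add_norm (E := H n) (μ := volume) (r := 2 * n + 2) (by simp)
  refine this.congr (Filter.Eventually.of_forall fun x => ?_)
  exact (Real.sq_sqrt (by positivity)).symm

/-- The form `α - ψ` is closed and compactly supported in `V`, hence orthogonal to the exact form
`ω`. -/
theorem setIntegral_wedgeTop_eq_of_weakDc {h : ℕ} (h1 : 1 ≤ h) (h2 : h ≤ 2 * n + 1) {p q : ℝ≥0∞}
    [p.HolderConjugate q] (hq : q ≠ ∞) {U V : Opens (H n)} (hUV : U ≤ V) {ω ψ : H n → Cov n}
    (hω : IsLpForm h p V ω) (hex : IsDcExact h V ω) {α : 𝓓(U, Cov n)}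
    (hα : IsTestForm (2 * n + 1 - h) α) (hψ : IsLpForm (2 * n + 1 - h) q V ψ)
    (hψs : CompactlySupportedIn V ψ) (hdc : WeakDc (2 * n + 2 - h) V ψ (dc α)) :
    ∫ x in (U : Set (H n)), wedgeTop (ω x) (α x) =
      ∫ x in (V : Set (H n)), wedgeTop (ω x) (ψ x) := by
  have hα0 : ∀ x ∉ (U : Set (H n)), α x = 0 := fun x hx =>
    image_eq_zero_of_notMem_tsupport fun h => hx (α.tsupport_subset h)
  have hαq : MemLp α q (volume.restrict (V : Set (H n))) :=
    memLp_testFunction α.continuous α.hasCompactSupport q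
  have hq1 : 1 ≤ q := ENNReal.HolderConjugate.one_le q p
  have key := setIntegral_wedgeTop_eq_zero_of_closed h1 h2 (q := q) hq hω hex
    (χ := fun x => α x - ψ x) ⟨hαq.sub hψ.memLp, ?_⟩ ?_ ?_
  · simp only [← wedgeTopL_apply, map_sub] at key ⊢
    rw [integral_sub (by simpa using integrable_wedgeTop_of_memLp hω.memLp hαq)
      (by simpa using integrable_wedgeTop_of_memLp hω.memLp hψ.memLp), sub_eq_zero] at key
    rw [← key, setIntegral_eq_integral_of_forall_compl_eq_zero,
      setIntegral_eq_integral_of_forall_compl_eq_zero]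
    · exact fun x hx => by rw [hα0 x fun h => hx (hUV h), map_zero]
    · exact fun x hx => by rw [hα0 x hx, map_zero]
  · filter_upwards [hψ.mem_E₀] with x hx
    exact sub_mem (hα x) hx
  · obtain ⟨K, hK, hKV, hK0⟩ := hψs
    refine ⟨tsupport α ∪ K, α.hasCompactSupport.isCompact.union hK,
      Set.union_subset (α.tsupport_subset.trans hUV) hKV, ?_⟩
    filter_upwards [hK0] with x hx hxK
    rw [hx fun h => hxK (Or.inr h), image_eq_zero_of_notMem_tsupport fun h => hxK (Or.inl h),
      sub_zero]
  · intro β hβ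
    have hβ' := hβ
    rw [show h - 1 = 2 * n + 1 - (2 * n + 2 - h) by omega] at hβ'
    have e1 := hdc β hβ'
    have e2 := integral_wedgeTop_dc α.contDiff β.contDiff β.hasCompactSupport hα
      fun x => (hβ x).2
    have hdcβ : ∀ x ∉ (V : Set (H n)), dc β x = 0 := fun x hx =>
      image_eq_zero_of_notMem_tsupport fun h => hx (β.tsupport_subset (tsupport_dc _ h))
    have hβ0 : ∀ x ∉ (V : Set (H n)), β x = 0 := fun x hx =>
      image_eq_zero_of_notMem_tsupport fun h => hx (β.tsupport_subset h)
    rw [setIntegral_eq_integral_of_forall_compl_eq_zero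
      (fun x hx => by rw [hβ0 x hx, ← wedgeTopL_apply, map_zero]), e2,
      show 2 * n + 1 - h + 1 = 2 * n + 2 - h by omega,
      ← setIntegral_eq_integral_of_forall_compl_eq_zero (s := (V : Set (H n)))
      (fun x hx => by rw [hdcβ x hx, ← wedgeTopL_apply, map_zero])] at e1
    -- The smooth form `α` and the weak primitive `ψ` satisfy the same identity with the same sign
    -- `(-1)^(2n+2-h)`, which cancels.
    have e3 := mul_left_cancel₀ (pow_ne_zero _ (by norm_num)) e1
    have hm : ∀ r, MemLp (dc β) r (volume.restrict (V : Set (H n))) :=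
      memLp_testFunction (contDiff_dc β.contDiff).continuous (hasCompactSupport_dc β.hasCompactSupport)
    have : q.HolderConjugate p := ENNReal.HolderConjugate.symm
    simp only [← wedgeTopL_apply, map_sub, FunLike.coe_sub, Pi.sub_apply] at e3 ⊢
    rw [integral_sub (by simpa using integrable_wedgeTop_of_memLp hαq (hm p))
      (by simpa using integrable_wedgeTop_of_memLp hψ.memLp (hm p)), e3, sub_self]

/-- The common core of the interior and global cases. The Sobolev inequality enters only for the
forms `d_c α`, and turns into the `L^1` bound required to represent `d_c α ↦ ± ∫ ω ∧ α` by a bounded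
form. -/
theorem exists_bounded_primitive {h : ℕ} (h1 : 1 ≤ h) (h2 : h ≤ 2 * n + 1) {p q : ℝ≥0∞}
    [p.HolderConjugate q] (hq : q ≠ ∞) {U V : Opens (H n)} (hUV : U ≤ V) {C : ℝ≥0}
    (hS : ∀ α : 𝓓(U, Cov n), IsTestForm (2 * n + 1 - h) α →
      ∃ ψ : H n → Cov n, IsLpForm (2 * n + 1 - h) q V ψ ∧ CompactlySupportedIn V ψ ∧
        WeakDc (2 * n + 2 - h) V ψ (dc α) ∧ lpNorm q V ψ ≤ C * lpNorm 1 U (dc α))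
    {ω : H n → Cov n} (hω : IsLpForm h p V ω) (hex : IsDcExact h V ω) :
    ∃ φ : H n → Cov n, IsLpForm (h - 1) ⊤ U φ ∧ WeakDc h U φ ω ∧
      lpNorm ⊤ U φ ≤ C * lpNorm p V ω := by
  have hfin : C * lpNorm p V ω ≠ ∞ := ENNReal.mul_ne_top ENNReal.coe_ne_top hω.memLp.2.ne
  have hfin' : C * eLpNorm ω p (volume.restrict (V : Set (H n))) ≠ ∞ := hfin
  set M : ℝ := (C * lpNorm p V ω).toReal with hM
  have hωU : MemLp ω p (volume.restrict (U : Set (H n))) :=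
    hω.memLp.mono_measure (Measure.restrict_mono hUV le_rfl)
  have hdcc : ∀ α : 𝓓(U, Cov n), Continuous (dc α) := fun α => (contDiff_dc α.contDiff).continuous
  have hdcs : ∀ α : 𝓓(U, Cov n), HasCompactSupport (dc α) := fun α =>
    hasCompactSupport_dc α.hasCompactSupport
  have hbound : ∀ α : 𝓓(U, Cov n), IsTestForm (2 * n + 1 - h) α →
      |∫ x in (U : Set (H n)), wedgeTop (ω x) (α x)| ≤
        M * ∫ x in (U : Set (H n)), ‖dc α x‖ := by
    intro α hα
    obtain ⟨ψ, hψ, hψs, hdc, hle⟩ := hS α hα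
    rw [setIntegral_wedgeTop_eq_of_weakDc h1 h2 hq hUV hω hex hα hψ hψs hdc]
    have h3 := (enorm_integral_wedgeTop_le hω.memLp hψ.memLp).trans (mul_le_mul_right hle _)
    have hi : Integrable (dc α) (volume.restrict (U : Set (H n))) :=
      ((hdcc α).integrable_of_hasCompactSupport (hdcs α)).restrict
    have h4 : lpNorm 1 U (dc α) = ENNReal.ofReal (∫ x in (U : Set (H n)), ‖dc α x‖) := by
      rw [lpNorm, eLpNorm_one_eq_lintegral_enorm, ofReal_integral_norm_eq_lintegral_enorm hi]
    rw [h4, ← mul_assoc, mul_comm (eLpNorm ω p _), ← ENNReal.ofReal_toReal hfin',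
      ← ENNReal.ofReal_mul ENNReal.toReal_nonneg, ← ofReal_norm,
      ENNReal.ofReal_le_ofReal_iff (by positivity)] at h3
    exact h3
  obtain ⟨w, hw0, hwc, hw2⟩ := exists_weight n
  -- The factor `(-1)^h` is the one in the definition of the weak equation `d_c φ = ω`.
  let l : testForms (2 * n + 1 - h) U →ₗ[ℝ] ℝ :=
    { toFun := fun α => (-1) ^ h * ∫ x in (U : Set (H n)), wedgeTop (ω x) (α.1 x)
      map_add' := fun α β => by
        have hi : ∀ α : 𝓓(U, Cov n), Integrable (fun x => wedgeTopL (ω x) (α x))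
            (volume.restrict (U : Set (H n))) := fun α => by
          simpa using integrable_wedgeTop_of_memLp (q := q) hωU
            (memLp_testFunction α.continuous α.hasCompactSupport _)
        simp only [← wedgeTopL_apply]
        rw [← mul_add, ← integral_add (hi _) (hi _)]
        simp only [← map_add]
        rfl
      map_smul' := fun c α => by
        rw [RingHom.id_apply, smul_eq_mul, mul_left_comm, ← integral_const_mul c]
        simp only [← wedgeTopL_apply, ← smul_eq_mul c, ← map_smul]
        rfl }
  obtain ⟨G, hGm, hGM, hG⟩ := exists_bounded_representation
    (μ := volume.restrict (U : Set (H n))) hw0 hwc.measurable (hw2.restrict _)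
    (A := fun α : testForms (2 * n + 1 - h) U => dc α.1)
    (fun α β => funext fun x => dc_add α.1.contDiff β.1.contDiff x)
    (fun c α => funext fun x => dc_smul α.1.contDiff c x)
    (fun α => memLp_testFunction
      ((hwc.inv₀ fun x => (hw0 x).ne').smul (hdcc α.1)) (hdcs α.1).smul_left 2)
    l (M := M) ENNReal.toReal_nonneg (fun α => by
      have : |l α| = |∫ x in (U : Set (H n)), wedgeTop (ω x) (α.1 x)| := by
        simp [l, abs_mul]
      rw [this]
      exact hbound α.1 α.2)
  -- Projecting `G` on `E₀^(2n+2-h)` keeps its pairing with `d_c α` and does not increase its norm.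
  -- The inverse of `star` turns the inner product into a wedge and lands in degree `h - 1`.
  set φ : H n → Cov n := fun x =>
    star.symm ((E₀ n (2 * n + 2 - h)).starProjection (G x)) with hφ
  have hφm : AEStronglyMeasurable φ (volume.restrict (U : Set (H n))) :=
    (star.symm.continuous.comp
      (E₀ n (2 * n + 2 - h)).starProjection.continuous).comp_aestronglyMeasurable hGm
  have hφM : ∀ᵐ x ∂volume.restrict (U : Set (H n)), ‖φ x‖ ≤ M := by
    filter_upwards [hGM] with x hx
    rw [hφ, LinearIsometryEquiv.norm_map]
    exact ((E₀ n (2 * n + 2 - h)).norm_starProjection_apply_le _).trans hx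
  refine ⟨φ, ⟨memLp_top_of_bound hφm M hφM, Filter.Eventually.of_forall fun x => ?_⟩, ?_, ?_⟩
  · have := star_symm_mem_E₀ (by omega)
      (Submodule.starProjection_apply_mem (E₀ n (2 * n + 2 - h)) (G x))
    rwa [show 2 * n + 1 - (2 * n + 2 - h) = h - 1 by omega] at this
  · intro α hα
    have h3 := hG ⟨α, hα⟩
    have h4 : ∀ x, wedgeTop (φ x) (dc α x) = inner ℝ (G x) (dc α x) := by
      intro x
      have h5 := dc_mem_E₀ α.contDiff hα x
      rw [show 2 * n + 1 - h + 1 = 2 * n + 2 - h by omega] at h5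
      rw [wedgeTop_eq_inner, hφ, LinearIsometryEquiv.apply_symm_apply,
        Submodule.inner_starProjection_left_eq_right, Submodule.starProjection_eq_self_iff.2 h5]
    simp only [h4, ← h3]
    have h6 : l ⟨α, hα⟩ = (-1) ^ h * ∫ x in (U : Set (H n)), wedgeTop (ω x) (α x) := rfl
    rw [h6, ← mul_assoc, ← mul_pow]
    simp
  · rw [lpNorm, eLpNorm_exponent_top]
    refine (eLpNormEssSup_le_of_ae_bound hφM).trans ?_
    rw [ENNReal.ofReal_toReal hfin]

/-! ### From Sobolev inequalities to Poincaré inequalities -/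

theorem kball_mono {p : H n} {r s : ℝ} (h : r ≤ s) : kball p r ≤ kball p s :=
  fun _ hx => lt_of_lt_of_le hx h

theorem isLpForm_dc {m : ℕ} {U : Opens (H n)} {α : 𝓓(U, Cov n)} (hα : IsTestForm m α)
    (p : ℝ≥0∞) : IsLpForm (m + 1) p U (dc α) :=
  ⟨memLp_testFunction (contDiff_dc α.contDiff).continuous
    (hasCompactSupport_dc α.hasCompactSupport) p,
    Filter.Eventually.of_forall (dc_mem_E₀ α.contDiff hα)⟩

theorem compactlySupportedIn_dc {U : Opens (H n)} (α : 𝓓(U, Cov n)) :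
    CompactlySupportedIn U (dc α) :=
  ⟨tsupport α, α.hasCompactSupport, α.tsupport_subset, Filter.Eventually.of_forall fun _ hx =>
    image_eq_zero_of_notMem_tsupport fun h => hx (tsupport_dc _ h)⟩

theorem interiorPoincare_of_interiorSobolev {h : ℕ} (h1 : 1 ≤ h) (h2 : h ≤ 2 * n + 1)
    {p q : ℝ≥0∞} [p.HolderConjugate q] (hq : q ≠ ∞) (hS : InteriorSobolev n (2 * n + 2 - h) 1 q) :
    InteriorPoincare n h p ⊤ := by
  obtain ⟨l, hl, C, hC⟩ := hS
  refine ⟨l, hl, C, fun ω hω hex =>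
    exists_bounded_primitive h1 h2 hq (kball_mono hl.le) (fun α hα => ?_) hω hex⟩
  have e : 2 * n + 1 - h + 1 = 2 * n + 2 - h := by omega
  have hex' := isDcExact_dc α hα
  have hLp := isLpForm_dc hα 1
  rw [e] at hex' hLp
  obtain ⟨ψ, hψ1, hψ2, hψ3, hψ4⟩ := hC (dc α) hLp (compactlySupportedIn_dc α) hex'
  rw [show 2 * n + 2 - h - 1 = 2 * n + 1 - h by omega] at hψ1
  -- The form `d_c α` is already zero outside the unit ball, so extension by zero does not change
  -- it.
  rw [Set.indicator_eq_self.2 ((subset_tsupport _).trans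
    ((tsupport_dc _).trans α.tsupport_subset))] at hψ3
  exact ⟨ψ, hψ1, hψ2, hψ3, hψ4⟩

theorem globalPoincare_of_globalSobolev {h : ℕ} (h1 : 1 ≤ h) (h2 : h ≤ 2 * n + 1)
    {p q : ℝ≥0∞} [p.HolderConjugate q] (hq : q ≠ ∞) (hS : GlobalSobolev n (2 * n + 2 - h) 1 q) :
    GlobalPoincare n h p ⊤ := by
  obtain ⟨C, hC⟩ := hS
  refine ⟨C, fun ω hω hex =>
    exists_bounded_primitive h1 h2 hq le_rfl (fun α hα => ?_) hω hex⟩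
  have e : 2 * n + 1 - h + 1 = 2 * n + 2 - h := by omega
  have hex' := isDcExact_dc α hα
  have hLp := isLpForm_dc hα 1
  rw [e] at hex' hLp
  obtain ⟨ψ, hψ1, hψ2, hψ3, hψ4⟩ := hC (dc α) hLp (compactlySupportedIn_dc α) hex'
  rw [show 2 * n + 2 - h - 1 = 2 * n + 1 - h by omega] at hψ1
  exact ⟨ψ, hψ1, hψ2, hψ3, hψ4⟩

end

end Heisenberg

theorem mainTheorem7 (n h : ℕ) (hh : 2 ≤ h) (hh' : h ≤ 2 * n + 1) (p p' : ℝ) (hp : 1 < p)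
    (hpp' : p.HolderConjugate p') :
    (Heisenberg.InteriorSobolev n (2 * n + 2 - h) 1 (ENNReal.ofReal p') →
      Heisenberg.InteriorPoincare n h (ENNReal.ofReal p) ⊤) ∧
    (Heisenberg.GlobalSobolev n (2 * n + 2 - h) 1 (ENNReal.ofReal p') →
      Heisenberg.GlobalPoincare n h (ENNReal.ofReal p) ⊤) := by
  have := hpp'.ennrealOfReal
  have h1 : 1 ≤ h := by omega
  exact ⟨Heisenberg.interiorPoincare_of_interiorSobolev h1 hh' ENNReal.ofReal_ne_top,
    Heisenberg.globalPoincare_of_globalSobolev h1 hh' ENNReal.ofReal_ne_top⟩
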